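/- Let $J=[n]\sqcup[n]^*$ with the fixed-point-free involution $a\mapsto a^*$. For $A\subseteq J$ let $A^*=\{a^*: a\in A\}$, and call $A$ admissible if $A\cap A^*=\emptyset$. An admissible matroid is a loopless matroid $\mathcal M$ on $J$ such that for every $A\subseteq J$ the rank $r(A)$ is the maximum, over all admissible independent sets $I\subseteq A$, of the number which is $|I|+2$ if there is a pair $\{a,a^*\}\subseteq A$ for which $I\cup\{a\}$ and $I\cup\{a^*\}$ are both independent with admissible closure, and which is $|I|$ otherwise. A ranked symplectic matroid $\mathcal S$ is the (nonempty) family of admissible bases of an admissible matroid $\mathcal M$, called an enveloping matroid of $\mathcal S$; its rank is the common size of its members. Let $L(\mathcal S)$ consist of the admissible flats of $\mathcal M$ and $J$. For $F\subseteq J$ put $e_F^\pm=\sum_{i\in F\cap[n]}e_i-\sum_{i^*\in F\cap[n]^*}e_i\in\mathbb R^n$. The Bergman fan $B(\mathcal S)$ consists of the cones $\{\sum_{j} a_j e^\pm_{F_j}: a_j\ge 0\}$ for all (possibly empty) chains $F_1\subsetneq\dots\subsetneq F_k$ in $L(\mathcal S)\setminus\{\emptyset,J\}$. For a cone $\sigma$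 let $N_\sigma$ be the set of points of $\mathbb Z^n$ in the linear span of $\sigma$. A Minkowski weight of dimension $d$ on $B(\mathcal S)$ is an integer-valued function $c$ on the $d$-dimensional cones such that for every $(d-1)$-dimensional cone $\tau$ the sum $\sum_{\sigma\supset\tau}c(\sigma)e_{\sigma/\tau}$ over the $d$-dimensional cones containing $\tau$ lies in the linear span of $\tau$, where $e_{\sigma/\tau}\in\sigma$ represents a generator of $N_\sigma/N_\tau$; $MW_d(B(\mathcal S))$ is the group of these weights. **Theorem 5.12.** Let $\mathcal S$ be a ranked symplectic matroid of rank $d+1$ with enveloping matroid $\mathcal M$, and let $\sigma,\sigma'$ be maximal (that is, $d$-dimensional) cones of $B(\mathcal S)$. Then $c(\sigma)=c(\sigma')$ for all $c\in MW_d(B(\mathcal S))$ if and only if there is a sequence $\sigma=\sigma_1,\dots,\sigma_k=\sigma'$ ($k\ge1$) of $d$-dimensional cones of $B(\mathcal S)$ such that for each $i\in[k-1]$ $$\operatorname{rank}_{\mathcal M}\bigl((F_i\cup F_i^*)\cap(F_{i+1}\cup F_{i+1}^*)\bigr)=d+1,$$ where $F_i$ is the largest flat in the chain of flats corresponding to $\sigma_i$.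 Moreover, $MW_d(B(\mathcal S))$ consists exactly of the integer-valued functions $c$ on the $d$-dimensional cones with $c(\sigma)=c(\sigma')$ whenever $\sigma$ and $\sigma'$ are joined by such a sequence. -/

import Mathlib

namespace RankedSymplectic

/-- The ground set `J = [n] ⊔ [n]*`: `Sum.inl i` is the element `i` and `Sum.inr i` is `i*`. -/
abbrev J (n : ℕ) : Type := Fin n ⊕ Fin n

/-- The involution `a ↦ a*` on `J`. -/
def star {n : ℕ} (a : J n) : J n := Sum.swap a

/-- The set `A* = {a* | a ∈ A}`. -/
def starSet {n : ℕ} (A : Set (J n)) : Set (J n) := star '' A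

/-- `A` is admissible if `A ∩ A* = ∅`. -/
def IsAdmissible {n : ℕ} (A : Set (J n)) : Prop := A ∩ starSet A = ∅

/-- `I^ad(M)`: the independent sets of `M` whose closure is admissible. -/
def indepAd {n : ℕ} (M : Matroid (J n)) : Set (Set (J n)) :=
  {I | M.Indep I ∧ IsAdmissible (M.closure I)}

open Classical in
/-- The number that an admissible independent set `I ⊆ A` contributes to the rank of `A`: it is
`|I| + 2` if some pair `{a, a*} ⊆ A` has `I ∪ {a}, I ∪ {a*} ∈ I^ad(M)`, and `|I|` otherwise. -/
noncomputable def rankCandidate {n : ℕ} (M : Matroid (J n)) (A I : Set (J n)) : ℕ∞ :=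
  if ∃ a, a ∈ A ∧ star a ∈ A ∧ I ∪ {a} ∈ indepAd M ∧ I ∪ {star a} ∈ indepAd M then
    I.encard + 2
  else I.encard

/-- An admissible matroid: a loopless matroid on `J` whose rank function is derived from its
admissible independent sets. -/
structure IsAdmissibleMatroid {n : ℕ} (M : Matroid (J n)) : Prop where
  ground_eq : M.E = Set.univ
  loopless : M.Loopless
  rank_eq : ∀ A : Set (J n),
    IsGreatest {m | ∃ I, M.Indep I ∧ IsAdmissible I ∧ I ⊆ A ∧ m = rankCandidate M A I} (M.eRk A)

/-- `S` is the ranked symplectic matroid enveloped by the admissible matroid `M`: it is the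
(nonempty) family of the admissible bases of `M`. -/
structure IsEnvelopingMatroid {n : ℕ} (M : Matroid (J n)) (S : Set (Set (J n))) : Prop where
  admissible : IsAdmissibleMatroid M
  nonempty : S.Nonempty
  eq_bases : S = {B | M.IsBase B ∧ IsAdmissible B}

/-- The lattice of flats `L(S)`: the admissible flats of the enveloping matroid `M`, and `J`. -/
def latticeOfFlats {n : ℕ} (M : Matroid (J n)) : Set (Set (J n)) :=
  {F | M.IsFlat F ∧ IsAdmissible F} ∪ {Set.univ}

/-- A (possibly empty) flag `F₁ ⊊ ⋯ ⊊ F_k` in `L(S) \ {∅, J}`, as a set of flats. -/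
def IsFlag {n : ℕ} (M : Matroid (J n)) (𝓕 : Set (Set (J n))) : Prop :=
  𝓕 ⊆ latticeOfFlats M \ {∅, Set.univ} ∧ IsChain (· ⊆ ·) 𝓕

/-- The signed unit vector of `a ∈ J`: `e_i` for `i ∈ [n]`, and `-e_i` for `i* ∈ [n]*`. -/
def signedUnit {n : ℕ} : J n → (Fin n → ℝ)
  | Sum.inl i => Pi.single i 1
  | Sum.inr i => -Pi.single i 1

open Classical in
/-- The vector `e_A^± = ∑_{a ∈ A} e_a^±` in `ℝⁿ`. -/
noncomputable def signedVec {n : ℕ} (A : Set (J n)) : Fin n → ℝ :=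
  ∑ a : J n, if a ∈ A then signedUnit a else 0

/-- The cone of nonnegative combinations of the vectors `e_F^±`, `F ∈ 𝓕`. -/
def flagCone {n : ℕ} (𝓕 : Set (Set (J n))) : PointedCone ℝ (Fin n → ℝ) :=
  PointedCone.hull ℝ (signedVec '' 𝓕)

/-- The Bergman fan `B(S)`, as a set of cones in `ℝⁿ`. -/
def bergmanFan {n : ℕ} (M : Matroid (J n)) : Set (PointedCone ℝ (Fin n → ℝ)) :=
  flagCone '' {𝓕 | IsFlag M 𝓕}

/-- The Bergman fan has finitely many cones (so the sums over its cones below are finite). -/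
theorem bergmanFan_finite {n : ℕ} (M : Matroid (J n)) : (bergmanFan M).Finite :=
  (Set.toFinite _).image _

/-- The linear span of a cone. -/
def linSpan {n : ℕ} (σ : PointedCone ℝ (Fin n → ℝ)) : Submodule ℝ (Fin n → ℝ) :=
  Submodule.span ℝ (σ : Set (Fin n → ℝ))

/-- The dimension of a cone. -/
noncomputable def coneDim {n : ℕ} (σ : PointedCone ℝ (Fin n → ℝ)) : ℕ :=
  Module.finrank ℝ (linSpan σ)

/-- `Σ_k`: the `k`-dimensional cones of the fan `Σ`. -/
def conesOfDim {n : ℕ} (fan : Set (PointedCone ℝ (Fin n → ℝ))) (k : ℕ) :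
    Set (PointedCone ℝ (Fin n → ℝ)) :=
  {σ ∈ fan | coneDim σ = k}

/-- The lattice `N_σ`: the points of `ℤⁿ` in the linear span of `σ`. -/
def coneLattice {n : ℕ} (σ : PointedCone ℝ (Fin n → ℝ)) : AddSubgroup (Fin n → ℝ) where
  carrier := {x | x ∈ linSpan σ ∧ ∀ i, ∃ m : ℤ, x i = m}
  zero_mem' := ⟨zero_mem _, fun _ => ⟨0, by simp⟩⟩
  add_mem' := by
    rintro x y ⟨hx, hx'⟩ ⟨hy, hy'⟩
    refine ⟨add_mem hx hy, fun i => ?_⟩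
    obtain ⟨a, ha⟩ := hx' i
    obtain ⟨b, hb⟩ := hy' i
    exact ⟨a + b, by simp [ha, hb]⟩
  neg_mem' := by
    rintro x ⟨hx, hx'⟩
    refine ⟨neg_mem hx, fun i => ?_⟩
    obtain ⟨a, ha⟩ := hx' i
    exact ⟨-a, by simp [ha]⟩

/-- `v` is a representative in `σ` of a generator of the lattice `N_σ / N_τ`. -/
def IsNormalVector {n : ℕ} (σ τ : PointedCone ℝ (Fin n → ℝ)) (v : Fin n → ℝ) : Prop :=
  v ∈ σ ∧ coneLattice σ = coneLattice τ ⊔ AddSubgroup.zmultiples v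

/-- A weight `c : Σ_k → ℤ` is a Minkowski weight if for every `(k-1)`-dimensional cone `τ` of the
fan the sum of `c(σ) e_{σ/τ}` over the `k`-dimensional cones `σ ⊇ τ` lies in the span of `τ`.
Two representatives `e_{σ/τ}` in `σ` differ by an element of `N_τ`, so the
condition does not depend on how they are chosen. -/
def IsMinkowskiWeight {n : ℕ} (fan : Set (PointedCone ℝ (Fin n → ℝ))) (k : ℕ)
    (c : conesOfDim fan k → ℤ) : Prop :=
  ∀ τ ∈ fan, coneDim τ + 1 = k →
    ∃ e : {σ : conesOfDim fan k // τ ≤ σ.1} → (Fin n → ℝ),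
      (∀ σ, IsNormalVector σ.1.1 τ (e σ)) ∧
      ∑ᶠ σ : {σ : conesOfDim fan k // τ ≤ σ.1}, c σ.1 • e σ ∈ linSpan τ

/-- `F` is the largest flat of a flag whose cone is `σ`. -/
def IsTopFlat {n : ℕ} (M : Matroid (J n)) (σ : PointedCone ℝ (Fin n → ℝ)) (F : Set (J n)) :
    Prop :=
  ∃ 𝓕, IsFlag M 𝓕 ∧ flagCone 𝓕 = σ ∧ IsGreatest 𝓕 F

/-- One step of a chain of `d`-dimensional cones: the top flats `F`, `F'` of the two cones satisfy
`rank_M ((F ∪ F*) ∩ (F' ∪ F'*)) = d + 1`. -/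
def Linked {n : ℕ} (M : Matroid (J n)) (d : ℕ) (σ σ' : conesOfDim (bergmanFan M) d) : Prop :=
  ∃ F F', IsTopFlat M σ.1 F ∧ IsTopFlat M σ'.1 F' ∧
    M.eRk ((F ∪ starSet F) ∩ (F' ∪ starSet F')) = (d : ℕ∞) + 1

end RankedSymplectic

/-!
The cones of chains of admissible sets are simplicial and unimodular, so a Minkowski weight is a
function on complete flags that is balanced around every flag `𝓣` with one member missing. Such a
flag has a gap just above some `F`, and the flats that fill it partition the rest of the next
member `H`, or, if there is none, come in pairs containing `a` and `a*`. Balancing says in the first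
case that all fillings have equal weight, and in the second that the two flats of a pair do.

Exchanges at inner gaps connect all complete flags with the same largest flat, so the weight depends
on this flat alone. An exchange at the top replaces an element `a` of an independent set spanning
the largest flat by `a*`; hence an independent set `K ⊆ F ∪ F*` of size `d` with admissible closure
gives this closure the same weight as `F`. If `(F ∪ F*) ∩ (F' ∪ F'*)` has rank `d + 1`, it contains
such a `K`, and `F` and `F'` have the same weight. Conversely, any two flags that differ by an
exchange have largest flats satisfying this rank condition.
-/

namespace RankedSymplectic

open Set

section Rank

variable {α : Type*} {M : Matroid α} {F G X Y : Set α} {a : α}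

/-- The rank of a set as a natural number; it is `0` by convention on sets of infinite rank. -/
noncomputable def rk (M : Matroid α) (X : Set α) : ℕ := (M.eRk X).toNat

lemma rk_empty : rk M ∅ = 0 := by simp [rk]

lemma rk_closure (X : Set α) : rk M (M.closure X) = rk M X := by
  rw [rk, M.eRk_closure_eq, ← rk]

lemma rk_eq_ncard_of_indep (h : M.Indep X) : rk M X = X.ncard := by
  rw [rk, h.eRk_eq_encard, Set.ncard]

lemma closure_subset_of_isFlat (hF : M.IsFlat F) (h : X ⊆ F) : M.closure X ⊆ F :=
  hF.closure ▸ M.closure_subset_closure h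

lemma notMem_closure_of_indep_insert (h : M.Indep (insert a X)) (ha : a ∉ X) : a ∉ M.closure X := by
  simpa [insert_sdiff_self_of_notMem ha] using h.notMem_closure_sdiff_of_mem (mem_insert a X)

variable [M.RankFinite]

lemma coe_rk (X : Set α) : (rk M X : ℕ∞) = M.eRk X :=
  ENat.natCast_toNat (M.isRkFinite_set X).eRk_lt_top.ne

lemma rk_mono (h : X ⊆ Y) : rk M X ≤ rk M Y :=
  ENat.toNat_le_toNat (M.eRk_mono h) (M.isRkFinite_set Y).eRk_lt_top.ne

lemma rk_insert_of_notMem (haE : a ∈ M.E) (ha : a ∉ M.closure X) :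
    rk M (insert a X) = rk M X + 1 := by
  have h := M.eRk_insert_eq_add_one (X := X) ⟨haE, ha⟩
  rw [← coe_rk, ← coe_rk] at h
  exact_mod_cast h

lemma rk_insert_of_isFlat (hF : M.IsFlat F) (haE : a ∈ M.E) (ha : a ∉ F) :
    rk M (insert a F) = rk M F + 1 :=
  rk_insert_of_notMem haE (by rwa [hF.closure])

lemma eq_of_isFlat_of_rk_le (hF : M.IsFlat F) (hG : M.IsFlat G) (h : F ⊆ G)
    (hr : rk M G ≤ rk M F) : F = G := by
  refine h.antisymm fun a ha => by_contra fun haF => ?_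
  have h1 := rk_insert_of_isFlat hF (hG.subset_ground ha) haF
  have h2 : rk M (insert a F) ≤ rk M G := rk_mono (insert_subset ha h)
  omega

lemma rk_lt_of_ssubset (hF : M.IsFlat F) (hG : M.IsFlat G) (h : F ⊂ G) : rk M F < rk M G :=
  not_le.1 fun hr => h.ne (eq_of_isFlat_of_rk_le hF hG h.subset hr)

lemma closure_insert_eq_of_rk_le (hG : M.IsFlat G) (hX : X ⊆ G) (ha : a ∈ G)
    (haX : a ∉ M.closure X) (hr : rk M G ≤ rk M X + 1) : M.closure (insert a X) = G := by
  refine eq_of_isFlat_of_rk_le (M.isFlat_closure _) hG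
    (closure_subset_of_isFlat hG (insert_subset ha hX)) ?_
  rwa [rk_closure, rk_insert_of_notMem (hG.subset_ground ha) haX]

lemma exists_isFlat_covering {H L P Q : Set α} (hL : M.IsFlat L) (hP : M.IsFlat P)
    (hQ : M.IsFlat Q) (hH : M.IsFlat H) (hLP : L ⊆ P) (hLQ : L ⊆ Q) (hPH : P ⊆ H) (hQH : Q ⊆ H)
    (hPr : rk M P = rk M L + 1) (hQr : rk M Q = rk M P) (hPQ : P ≠ Q) :
    ∃ K, M.IsFlat K ∧ P ⊆ K ∧ Q ⊆ K ∧ K ⊆ H ∧ rk M K = rk M P + 1 := by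
  obtain ⟨b, hb, hbP⟩ :=
    not_subset.1 fun hQP => hPQ (eq_of_isFlat_of_rk_le hQ hP hQP hQr.ge).symm
  have hQ_eq : M.closure (insert b L) = Q :=
    closure_insert_eq_of_rk_le hQ hLQ hb (fun hbL => hbP (hLP (hL.closure ▸ hbL))) (by omega)
  refine ⟨M.closure (insert b P), M.isFlat_closure _, ?_, ?_, ?_, ?_⟩
  · exact (subset_insert _ _).trans
      (M.subset_closure _ (insert_subset (hQ.subset_ground hb) hP.subset_ground))
  · exact hQ_eq ▸ M.closure_subset_closure (insert_subset_insert hLP)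
  · exact closure_subset_of_isFlat hH (insert_subset (hQH hb) hPH)
  · rw [rk_closure, rk_insert_of_isFlat hP (hQ.subset_ground hb) hbP]

end Rank

section Admissible

variable {n : ℕ} {A B : Set (J n)} {a : J n}

@[simp] lemma star_star (a : J n) : star (star a) = a := Sum.swap_swap a

lemma star_ne (a : J n) : star a ≠ a := by
  rcases a with i | i <;> exact nofun

lemma eq_star_comm {b : J n} : a = star b ↔ b = star a :=
  ⟨fun h => by rw [h, star_star], fun h => by rw [h, star_star]⟩

@[simp] lemma mem_starSet : a ∈ starSet A ↔ star a ∈ A :=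
  ⟨by rintro ⟨b, hb, rfl⟩; rwa [star_star], fun h => ⟨star a, h, star_star a⟩⟩

lemma isAdmissible_iff : IsAdmissible A ↔ ∀ a ∈ A, star a ∉ A := by
  simp [IsAdmissible, eq_empty_iff_forall_notMem]

lemma IsAdmissible.star_notMem (h : IsAdmissible A) (ha : a ∈ A) : star a ∉ A :=
  isAdmissible_iff.1 h a ha

lemma IsAdmissible.subset (h : IsAdmissible B) (hAB : A ⊆ B) : IsAdmissible A :=
  isAdmissible_iff.2 fun _ ha ha' => h.star_notMem (hAB ha) (hAB ha')

lemma IsAdmissible.ne_univ (h : IsAdmissible A) (ha : a ∈ A) : A ≠ univ := by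
  rintro rfl
  exact h.star_notMem ha (mem_univ _)

end Admissible

section AdmissibleMatroid

variable {n d : ℕ} {M : Matroid (J n)} {A C F I X : Set (J n)} {a : J n}

namespace IsAdmissibleMatroid

lemma mem_ground (hM : IsAdmissibleMatroid M) (a : J n) : a ∈ M.E :=
  hM.ground_eq ▸ mem_univ a

lemma subset_closure (hM : IsAdmissibleMatroid M) (X : Set (J n)) : X ⊆ M.closure X :=
  M.subset_closure X fun a _ => hM.mem_ground a

lemma indep_singleton (hM : IsAdmissibleMatroid M) (a : J n) : M.Indep {a} :=
  have := hM.loopless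
  Matroid.indep_singleton.2 (Matroid.isNonloop_of_loopless (hM.mem_ground a))

lemma isFlat_empty (hM : IsAdmissibleMatroid M) : M.IsFlat ∅ := by
  have := hM.loopless
  rw [Matroid.isFlat_iff_closure_eq, Matroid.closure_empty, M.loops_eq_empty]

lemma admissible_of_mem_indepAd (hM : IsAdmissibleMatroid M) (h : I ∈ indepAd M) :
    IsAdmissible I := h.2.subset (hM.subset_closure I)

/-- The set realizing the rank of an independent set that contains a pair `a, a*` cannot be the
whole set, so it misses exactly this pair. -/
lemma admissible_closure_sdiff_singleton (hM : IsAdmissibleMatroid M) (hA : M.Indep A)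
    (ha : a ∈ A) (ha' : star a ∈ A) : IsAdmissible (M.closure (A \ {a})) := by
  obtain ⟨I, -, hI, hIA, hrank⟩ := (hM.rank_eq A).1
  rw [hA.eRk_eq_encard, rankCandidate] at hrank
  split_ifs at hrank with h
  · obtain ⟨q, hq, hq', h1, h2⟩ := h
    have hqI : q ∉ I := fun h => (hM.admissible_of_mem_indepAd h2).star_notMem (.inl h) (.inr rfl)
    have hqI' : star q ∉ I := fun h =>
      (hM.admissible_of_mem_indepAd h1).star_notMem (.inr rfl) (.inl h)
    have hA_eq : insert q (insert (star q) I) = A := by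
      refine (toFinite _).eq_of_subset_of_encard_le (insert_subset hq (insert_subset hq' hIA)) ?_
      rw [hrank, encard_insert_of_notMem (by simp [hqI, (star_ne q).symm]),
        encard_insert_of_notMem hqI', add_assoc, one_add_one_eq_two]
    have hpair : a = q ∨ a = star q := by
      by_contra! hne
      have hmem : ∀ b ∈ A, b ≠ q → b ≠ star q → b ∈ I := fun b hb hbq hbq' => by
        simpa [← hA_eq, hbq, hbq'] using hb
      exact hI.star_notMem (hmem a ha hne.1 hne.2) (hmem _ ha' (fun h => hne.2
        (eq_star_comm.1 h.symm)) fun h => hne.1 (by simpa using congrArg star h))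
    rcases hpair with rfl | rfl
    · refine h2.2.subset (M.closure_subset_closure ?_)
      rintro b ⟨hb, hba⟩
      simpa [← hA_eq, show b ≠ a from hba, or_comm] using hb
    · refine h1.2.subset (M.closure_subset_closure ?_)
      rintro b ⟨hb, hba⟩
      simpa [← hA_eq, show b ≠ star q from hba, or_comm] using hb
  · obtain rfl := (toFinite I).eq_of_subset_of_encard_le hIA hrank.le
    exact absurd ha' (hI.star_notMem ha)

lemma star_mem (hM : IsAdmissibleMatroid M) (hF : M.IsFlat F) (hadm : ¬ IsAdmissible F)
    (ha : a ∈ F) : star a ∈ F := by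
  by_contra ha'
  obtain ⟨K, hK, haK⟩ := (hM.indep_singleton a).subset_isBasis_of_subset (singleton_subset_iff.2 ha)
  have hKF : M.closure K = F := hK.closure_eq_closure.trans hF.closure
  have haK' : star a ∉ K := fun h => ha' (hK.subset h)
  have hA : M.Indep (insert (star a) K) :=
    (hK.indep.insert_indep_iff_of_notMem haK').2 ⟨hM.mem_ground _, hKF ▸ ha'⟩
  have hsdiff := hM.admissible_closure_sdiff_singleton hA (mem_insert _ _)
    (.inr (by simpa using haK))
  rw [insert_sdiff_self_of_notMem haK', hKF] at hsdiff
  exact hadm hsdiff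

lemma admissible_closure_insert_star (hM : IsAdmissibleMatroid M)
    (h : IsAdmissible (M.closure (insert a X))) (ha : a ∉ M.closure X) :
    IsAdmissible (M.closure (insert (star a) X)) := by
  by_contra hn
  have hs := hM.subset_closure (insert (star a) X)
  have ha' : a ∈ M.closure (insert (star a) X) := by
    simpa using hM.star_mem (M.isFlat_closure _) hn (hs (mem_insert _ _))
  exact hn (Matroid.closure_insert_congr ⟨ha', ha⟩ ▸ h)

lemma mem_indepAd_insert (hM : IsAdmissibleMatroid M) (hI : I ∈ indepAd M)
    (ha : a ∉ M.closure I) (h : IsAdmissible (M.closure (insert a I))) : insert a I ∈ indepAd M :=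
  ⟨hI.1.insert_indep_iff.2 (.inl ⟨hM.mem_ground a, ha⟩), h⟩

lemma insert_star_mem_indepAd (hM : IsAdmissibleMatroid M) (h : insert a X ∈ indepAd M)
    (ha : a ∉ X) : insert (star a) X ∈ indepAd M := by
  have hcl : M.closure X ⊆ M.closure (insert a X) := M.closure_subset_closure (subset_insert _ _)
  refine hM.mem_indepAd_insert ⟨h.1.subset (subset_insert _ _), h.2.subset hcl⟩
    (fun hs => ?_) (hM.admissible_closure_insert_star h.2 (notMem_closure_of_indep_insert h.1 ha))
  exact h.2.star_notMem (hM.subset_closure _ (mem_insert a X)) (hcl hs)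

/-- If nothing in `C` extends `I`, then adjoining any `a ∈ C` outside the closure of `I` produces a
flat stable under the involution, which is therefore spanned by `I` and `x*` for any fixed
`x ∈ I`. -/
lemma rk_le_of_maximal (hM : IsAdmissibleMatroid M) (hI : I ∈ indepAd M) (hne : I.Nonempty)
    (hmax : ∀ a ∈ C, a ∉ M.closure I → insert a I ∉ indepAd M) : rk M C ≤ I.ncard + 1 := by
  obtain ⟨x, hx⟩ := hne
  have hx' : star x ∉ M.closure I := hI.2.star_notMem (hM.subset_closure I hx)
  have hC : C ⊆ M.closure (insert (star x) I) := fun a ha => by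
    by_cases haI : a ∈ M.closure I
    · exact M.closure_subset_closure (subset_insert _ _) haI
    have hsub := hM.subset_closure (insert a I)
    have hstar : star x ∈ M.closure (insert a I) :=
      hM.star_mem (M.isFlat_closure _)
        (fun h => hmax a ha haI (hM.mem_indepAd_insert hI haI h)) (hsub (.inr hx))
    rw [Matroid.closure_insert_congr ⟨hstar, hx'⟩]
    exact hsub (mem_insert _ _)
  calc rk M C ≤ rk M (M.closure (insert (star x) I)) := rk_mono hC
    _ = I.ncard + 1 := by
      rw [rk_closure, rk_insert_of_notMem (hM.mem_ground _) hx', rk_eq_ncard_of_indep hI.1]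

lemma exists_indepAd_subset (hM : IsAdmissibleMatroid M) (hI : I ∈ indepAd M) (hne : I.Nonempty)
    (hIC : I ⊆ C) : ∃ K ∈ indepAd M, K ⊆ C ∧ rk M C ≤ K.ncard + 1 := by
  obtain ⟨K, hIK, ⟨hK, hKC⟩, hmax⟩ :=
    (toFinite {K | K ∈ indepAd M ∧ K ⊆ C}).exists_le_maximal ⟨hI, hIC⟩
  refine ⟨K, hK, hKC, hM.rk_le_of_maximal hK (hne.mono hIK) fun a ha haK hins => haK ?_⟩
  exact hM.subset_closure K (hmax ⟨hins, insert_subset ha hKC⟩ (subset_insert _ _)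
    (mem_insert a K))

lemma rk_le_of_admissible (hM : IsAdmissibleMatroid M) (hr : rk M univ = d + 1)
    (hF : M.IsFlat F) (hadm : IsAdmissible F) : rk M F ≤ d := by
  rcases F.eq_empty_or_nonempty with rfl | ⟨a, ha⟩
  · simp [rk_empty]
  have := rk_lt_of_ssubset hF (hM.ground_eq ▸ M.ground_isFlat)
    (ssubset_univ_iff.2 (hadm.ne_univ ha))
  omega

end IsAdmissibleMatroid

end AdmissibleMatroid

section Coordinates

variable {n : ℕ} {A : Set (J n)} {a : J n} {x y : Fin n → ℝ}

/-- The linear functional dual to `signedUnit a`: the coordinate `x ↦ x i` for `a = i`, and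
`x ↦ -x i` for `a = i*`. -/
def coord : J n → (Fin n → ℝ) →ₗ[ℝ] ℝ
  | Sum.inl i => LinearMap.proj i
  | Sum.inr i => -LinearMap.proj i

lemma coord_star (a : J n) (x : Fin n → ℝ) : coord (star a) x = -coord a x := by
  rcases a with i | i <;> simp [coord, star]

lemma eq_of_coord_eq (h : ∀ a, coord a x = coord a y) : x = y :=
  funext fun i => h (Sum.inl i)

open Classical in
lemma coord_signedUnit (a b : J n) :
    coord a (signedUnit b) = (if a = b then 1 else 0) - if star a = b then 1 else 0 := by
  rcases a with i | i <;> rcases b with j | j <;> simp [coord, signedUnit, star, Pi.single_apply]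

open Classical in
lemma coord_signedVec (a : J n) (A : Set (J n)) :
    coord a (signedVec A) = (if a ∈ A then 1 else 0) - if star a ∈ A then 1 else 0 := by
  have hterm (b : J n) : coord a (if b ∈ A then signedUnit b else 0) =
      (if a = b then if b ∈ A then 1 else 0 else 0) -
        if star a = b then if b ∈ A then 1 else 0 else 0 := by
    split_ifs <;> simp_all [coord_signedUnit]
  simp only [signedVec, map_sum, hterm, Finset.sum_sub_distrib, Finset.sum_ite_eq, Finset.mem_univ,
    if_true]

lemma coord_signedVec_of_mem (hA : IsAdmissible A) (ha : a ∈ A) : coord a (signedVec A) = 1 := by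
  simp [coord_signedVec, ha, hA.star_notMem ha]

lemma coord_signedVec_of_notMem (ha : a ∉ A) (ha' : star a ∉ A) : coord a (signedVec A) = 0 := by
  simp [coord_signedVec, ha, ha']

lemma signedVec_empty : signedVec (∅ : Set (J n)) = 0 := by simp [signedVec]

/-- The elements of `J` whose coordinate is positive at `x`. On the cone of a chain of admissible
sets it returns the largest member of the chain that occurs with a nonzero coefficient. -/
def posSet (x : Fin n → ℝ) : Set (J n) := {a | 0 < coord a x}

@[simp] lemma mem_posSet : a ∈ posSet x ↔ 0 < coord a x := Iff.rfl

lemma posSet_zero : posSet (0 : Fin n → ℝ) = ∅ := by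
  ext a
  simp

lemma posSet_smul {r : ℝ} (hr : 0 < r) (x : Fin n → ℝ) : posSet (r • x) = posSet x := by
  ext a
  simp [hr]

lemma posSet_signedVec (hA : IsAdmissible A) : posSet (signedVec A) = A := by
  ext a
  rw [mem_posSet]
  by_cases ha : a ∈ A
  · simp [coord_signedVec_of_mem hA ha, ha]
  · rw [coord_signedVec, if_neg ha]
    split_ifs <;> simp [ha]

lemma posSet_add_of_subset (h : posSet x ⊆ posSet y) : posSet (x + y) = posSet y := by
  ext a
  have ha := @h a
  have ha' := @h (star a)
  simp only [mem_posSet, coord_star, map_add] at ha ha' ⊢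
  constructor <;> intro h' <;> by_contra! <;> grind

/-- The points of the lattice `ℤⁿ` in `ℝⁿ`. -/
def IsLatticePoint (x : Fin n → ℝ) : Prop := ∀ i, ∃ m : ℤ, x i = m

lemma IsLatticePoint.coord (h : IsLatticePoint x) (a : J n) :
    ∃ m : ℤ, RankedSymplectic.coord a x = m := by
  rcases a with i | i
  · exact h i
  · obtain ⟨m, hm⟩ := h i
    exact ⟨-m, by simp [RankedSymplectic.coord, hm]⟩

lemma isLatticePoint_signedVec (A : Set (J n)) : IsLatticePoint (signedVec A) := fun i => by
  classical
  exact ⟨(if Sum.inl i ∈ A then 1 else 0) - if star (Sum.inl i) ∈ A then 1 else 0,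
    (coord_signedVec (Sum.inl i) A).trans (by push_cast; rfl)⟩

end Coordinates

section Chains

variable {n : ℕ} {𝓕 𝓖 𝓣 : Set (Set (J n))} {F G : Set (J n)} {a : J n} {v x : Fin n → ℝ}

/-- A chain of nonempty admissible sets: all that the geometry of the cone of a flag uses. -/
structure AdmChain (𝓕 : Set (Set (J n))) : Prop where
  nonempty : ∀ F ∈ 𝓕, F.Nonempty
  admissible : ∀ F ∈ 𝓕, IsAdmissible F
  chain : IsChain (· ⊆ ·) 𝓕

lemma exists_isGreatest_of_isChain {β : Type*} [Preorder β] [Finite β] {s : Set β}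
    (h : IsChain (· ≤ ·) s) (hne : s.Nonempty) : ∃ x, IsGreatest s x := by
  obtain ⟨x, hx, hmax⟩ := (toFinite s).exists_maximal hne
  exact ⟨x, hx, fun y hy => (h.total hx hy).elim (fun hxy => hmax hy hxy) id⟩

lemma exists_isLeast_of_isChain {β : Type*} [Preorder β] [Finite β] {s : Set β}
    (h : IsChain (· ≤ ·) s) (hne : s.Nonempty) : ∃ x, IsLeast s x := by
  obtain ⟨x, hx, hmin⟩ := (toFinite s).exists_minimal hne
  exact ⟨x, hx, fun y hy => (h.total hx hy).elim id fun hyx => hmin hy hyx⟩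

lemma AdmChain.exists_mem_iff_subset (h : AdmChain 𝓕) (hF : F ∈ 𝓕) :
    ∃ a ∈ F, ∀ G ∈ 𝓕, a ∈ G ↔ F ⊆ G := by
  have hlow : ∃ a ∈ F, ∀ G ∈ 𝓕, G ⊂ F → a ∉ G := by
    by_cases hne : {G ∈ 𝓕 | G ⊂ F}.Nonempty
    · obtain ⟨G, hG, hmax⟩ := exists_isGreatest_of_isChain (h.chain.mono (sep_subset _ _)) hne
      obtain ⟨a, ha, haG⟩ := exists_of_ssubset hG.2
      exact ⟨a, ha, fun G' hG' hlt ha' => haG (hmax ⟨hG', hlt⟩ ha')⟩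
    · obtain ⟨a, ha⟩ := h.nonempty F hF
      exact ⟨a, ha, fun G hG hlt => (hne ⟨G, hG, hlt⟩).elim⟩
  obtain ⟨a, ha, hlt⟩ := hlow
  refine ⟨a, ha, fun G hG => ⟨fun haG => ?_, fun hFG => hFG ha⟩⟩
  by_contra hFG
  exact hlt G hG (((h.chain.total hF hG).resolve_left hFG).ssubset_of_not_subset hFG) haG

open Classical in
lemma AdmChain.coord_signedVec (h : AdmChain 𝓕) (hF : F ∈ 𝓕) (ha : a ∈ F) (hG : G ∈ 𝓕) :
    coord a (signedVec G) = if a ∈ G then 1 else 0 := by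
  have ha' : star a ∉ G := (h.chain.total hF hG).elim
    (fun hFG => (h.admissible G hG).star_notMem (hFG ha))
    (fun hGF h' => (h.admissible F hF).star_notMem ha (hGF h'))
  simp [RankedSymplectic.coord_signedVec, ha']

/-- The coefficient of `signedVec F` is read off as a difference of two coordinates, one that
appears first in `F` and one that appears first in the successor of `F`. -/
lemma AdmChain.exists_dual (h : AdmChain 𝓕) (hF : F ∈ 𝓕) :
    ∃ δ : (Fin n → ℝ) →ₗ[ℝ] ℝ, δ (signedVec F) = 1 ∧
      (∀ G ∈ 𝓕, G ≠ F → δ (signedVec G) = 0) ∧ ∀ x, IsLatticePoint x → ∃ m : ℤ, δ x = m := by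
  classical
  obtain ⟨a, ha, haG⟩ := h.exists_mem_iff_subset hF
  by_cases hne : {G ∈ 𝓕 | F ⊂ G}.Nonempty
  · obtain ⟨H, hH, hmin⟩ := exists_isLeast_of_isChain (h.chain.mono (sep_subset _ _)) hne
    obtain ⟨b, hb, hbG⟩ := h.exists_mem_iff_subset hH.1
    have hval : ∀ G ∈ 𝓕, (coord a - coord b) (signedVec G) =
        (if F ⊆ G then 1 else 0) - if H ⊆ G then 1 else 0 := fun G hG => by
      rw [LinearMap.sub_apply, h.coord_signedVec hF ha hG, h.coord_signedVec hH.1 hb hG]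
      simp only [haG G hG, hbG G hG]
    refine ⟨coord a - coord b, ?_, fun G hG hGF => ?_, fun x hx => ?_⟩
    · rw [hval F hF, if_pos subset_rfl, if_neg hH.2.not_subset, sub_zero]
    · have hiff : F ⊆ G ↔ H ⊆ G :=
        ⟨fun hFG => hmin ⟨hG, hFG.ssubset_of_ne hGF.symm⟩, hH.2.subset.trans⟩
      rw [hval G hG]
      simp only [hiff, sub_self]
    · obtain ⟨p, hp⟩ := hx.coord a
      obtain ⟨q, hq⟩ := hx.coord b
      exact ⟨p - q, by simp [hp, hq]⟩
  · refine ⟨coord a, coord_signedVec_of_mem (h.admissible F hF) ha, fun G hG hGF => ?_,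
      fun x hx => hx.coord a⟩
    rw [h.coord_signedVec hF ha hG, if_neg]
    rw [haG G hG]
    exact fun hFG => hne ⟨G, hG, hFG.ssubset_of_ne hGF.symm⟩

lemma AdmChain.linearIndependent (h : AdmChain 𝓕) :
    LinearIndependent ℝ (fun F : 𝓕 => signedVec F.1) := by
  choose δ h1 h0 _ using fun F : 𝓕 => h.exists_dual F.2
  exact .of_pairwise_dual_eq_zero_one _ δ
    (fun F G hFG => h0 F G G.2 fun hGF => hFG (Subtype.ext hGF.symm)) h1

lemma linSpan_flagCone (𝓕 : Set (Set (J n))) :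
    linSpan (flagCone 𝓕) = Submodule.span ℝ (signedVec '' 𝓕) :=
  Submodule.span_span_of_tower _ _ _

lemma linSpan_flagCone_le {P : Submodule ℝ (Fin n → ℝ)} :
    linSpan (flagCone 𝓕) ≤ P ↔ ∀ F ∈ 𝓕, signedVec F ∈ P := by
  rw [linSpan_flagCone, Submodule.span_le, image_subset_iff]
  rfl

lemma signedVec_mem_flagCone (hF : F ∈ 𝓕) : signedVec F ∈ flagCone 𝓕 :=
  Submodule.subset_span ⟨F, hF, rfl⟩

lemma signedVec_mem_linSpan (hF : F ∈ 𝓕) : signedVec F ∈ linSpan (flagCone 𝓕) :=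
  Submodule.subset_span (signedVec_mem_flagCone hF)

lemma signedVec_mem_coneLattice (hF : F ∈ 𝓕) : signedVec F ∈ coneLattice (flagCone 𝓕) :=
  ⟨signedVec_mem_linSpan hF, isLatticePoint_signedVec F⟩

lemma flagCone_mono (h : 𝓕 ⊆ 𝓖) : flagCone 𝓕 ≤ flagCone 𝓖 :=
  Submodule.span_mono (image_mono h)

lemma coneLattice_flagCone_mono (h : 𝓕 ⊆ 𝓖) :
    coneLattice (flagCone 𝓕) ≤ coneLattice (flagCone 𝓖) :=
  fun _ hx => ⟨Submodule.span_mono (flagCone_mono h) hx.1, hx.2⟩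

lemma AdmChain.coneDim_flagCone (h : AdmChain 𝓕) : coneDim (flagCone 𝓕) = 𝓕.ncard := by
  have : Fintype 𝓕 := Fintype.ofFinite _
  rw [coneDim, linSpan_flagCone, image_eq_range, finrank_span_eq_card h.linearIndependent,
    ← Nat.card_eq_fintype_card, Nat.card_coe_set_eq]

lemma AdmChain.posSet_mem (h : AdmChain 𝓕) (hx : x ∈ flagCone 𝓕) : posSet x ∈ insert ∅ 𝓕 := by
  have hchain : IsChain (· ⊆ ·) (insert ∅ 𝓕) := h.chain.insert fun _ _ _ => .inl (empty_subset _)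
  induction hx using Submodule.span_induction with
  | mem x hx =>
    obtain ⟨F, hF, rfl⟩ := hx
    exact .inr (by rwa [posSet_signedVec (h.admissible F hF)])
  | zero => exact .inl posSet_zero
  | add x y _ _ hx hy =>
    rcases hchain.total hx hy with hxy | hyx
    · rwa [posSet_add_of_subset hxy]
    · rwa [add_comm, posSet_add_of_subset hyx]
  | smul c x _ hx =>
    rcases c.2.eq_or_lt with hc | hc
    · obtain rfl : 0 = c := Subtype.ext hc
      exact .inl (by rw [zero_smul, posSet_zero])
    · exact (posSet_smul hc x).symm ▸ hx

lemma AdmChain.flagCone_le_iff (h𝓕 : AdmChain 𝓕) (h𝓖 : AdmChain 𝓖) :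
    flagCone 𝓕 ≤ flagCone 𝓖 ↔ 𝓕 ⊆ 𝓖 := by
  refine ⟨fun h F hF => ?_, flagCone_mono⟩
  have hpos := h𝓖.posSet_mem (h (signedVec_mem_flagCone hF))
  rw [posSet_signedVec (h𝓕.admissible F hF)] at hpos
  exact hpos.resolve_left (h𝓕.nonempty F hF).ne_empty

lemma AdmChain.flagCone_inj (h𝓕 : AdmChain 𝓕) (h𝓖 : AdmChain 𝓖) :
    flagCone 𝓕 = flagCone 𝓖 ↔ 𝓕 = 𝓖 := by
  rw [le_antisymm_iff, h𝓕.flagCone_le_iff h𝓖, h𝓖.flagCone_le_iff h𝓕, ← subset_antisymm_iff]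

/-- A functional that vanishes on the span of `𝓣`, equals `1` at `signedVec G` and is integral on
`ℤⁿ` splits off the direction of `signedVec G` compatibly with the lattices. -/
lemma AdmChain.exists_splitting (h : AdmChain (insert G 𝓣)) (hG : G ∉ 𝓣) :
    ∃ δ : (Fin n → ℝ) →ₗ[ℝ] ℝ, δ (signedVec G) = 1 ∧
      (∀ x ∈ linSpan (flagCone 𝓣), δ x = 0) ∧
      (∀ x ∈ flagCone (insert G 𝓣), 0 ≤ δ x) ∧
      ∀ x ∈ coneLattice (flagCone (insert G 𝓣)),
        ∃ m : ℤ, δ x = m ∧ x - m • signedVec G ∈ coneLattice (flagCone 𝓣) := by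
  obtain ⟨δ, h1, h0, hint⟩ := h.exists_dual (mem_insert G 𝓣)
  have hzero : linSpan (flagCone 𝓣) ≤ LinearMap.ker δ :=
    linSpan_flagCone_le.2 fun F hF => h0 F (.inr hF) (ne_of_mem_of_not_mem hF hG)
  refine ⟨δ, h1, hzero, fun x hx => ?_, fun x hx => ?_⟩
  · induction hx using Submodule.span_induction with
    | mem x hx =>
      obtain ⟨F, rfl | hF, rfl⟩ := hx
      · exact h1 ▸ zero_le_one
      · exact (hzero (signedVec_mem_linSpan hF)).ge
    | zero => rw [map_zero]
    | add x y _ _ hx hy => exact map_add δ x y ▸ add_nonneg hx hy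
    | smul c x _ hx => exact (map_smul δ (c : ℝ) x).symm ▸ mul_nonneg c.2 hx
  · obtain ⟨m, hm⟩ := hint x hx.2
    refine ⟨m, hm, ?_, ?_⟩
    · have hspan := hx.1
      rw [linSpan_flagCone, image_insert_eq, Submodule.mem_span_insert, ← linSpan_flagCone]
        at hspan
      obtain ⟨r, z, hz, rfl⟩ := hspan
      have hr : r = m := by
        rwa [map_add, map_smul, h1, hzero hz, smul_eq_mul, mul_one, add_zero] at hm
      rwa [hr, Int.cast_smul_eq_zsmul, add_sub_cancel_left]
    · exact sub_mem hx (zsmul_mem (signedVec_mem_coneLattice (mem_insert G 𝓣)) m) |>.2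

lemma AdmChain.isNormalVector_signedVec (h : AdmChain (insert G 𝓣)) (hG : G ∉ 𝓣) :
    IsNormalVector (flagCone (insert G 𝓣)) (flagCone 𝓣) (signedVec G) := by
  obtain ⟨δ, -, -, -, hsplit⟩ := h.exists_splitting hG
  refine ⟨signedVec_mem_flagCone (mem_insert _ _), le_antisymm (fun x hx => ?_) ?_⟩
  · obtain ⟨m, -, hm⟩ := hsplit x hx
    exact sub_add_cancel x (m • signedVec G) ▸
      AddSubgroup.add_mem_sup hm (AddSubgroup.zsmul_mem_zmultiples _ m)
  · exact sup_le (coneLattice_flagCone_mono (subset_insert _ _))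
      ((AddSubgroup.zmultiples_le).2 (signedVec_mem_coneLattice (mem_insert _ _)))

/-- The functional `δ` of the splitting takes a generator of the quotient lattice to `±1`, and a
point of the cone to a nonnegative number. -/
lemma AdmChain.sub_mem_of_isNormalVector (h : AdmChain (insert G 𝓣)) (hG : G ∉ 𝓣)
    (hv : IsNormalVector (flagCone (insert G 𝓣)) (flagCone 𝓣) v) :
    v - signedVec G ∈ linSpan (flagCone 𝓣) := by
  obtain ⟨δ, h1, hzero, hnonneg, hsplit⟩ := h.exists_splitting hG
  have hvmem : v ∈ coneLattice (flagCone (insert G 𝓣)) :=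
    hv.2 ▸ AddSubgroup.mem_sup_right (AddSubgroup.mem_zmultiples v)
  obtain ⟨k, hk, hvk⟩ := hsplit v hvmem
  have hGmem := signedVec_mem_coneLattice (mem_insert G 𝓣)
  rw [hv.2, AddSubgroup.mem_sup] at hGmem
  obtain ⟨w, hw, _, ⟨m, rfl⟩, hwm⟩ := hGmem
  have hmk : m * k = 1 := by
    have := congrArg δ hwm
    rw [map_add, hzero w hw.1, zero_add, h1] at this
    change δ (m • v) = 1 at this
    rw [map_zsmul, hk, zsmul_eq_mul] at this
    exact_mod_cast this
  have hk_nonneg : 0 ≤ k := by exact_mod_cast hk ▸ hnonneg v hv.1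
  have hk1 : k = 1 := by
    rcases Int.eq_one_or_neg_one_of_mul_eq_one' hmk with hm | hm <;> omega
  simpa [hk1] using hvk.1

end Chains

section Flags

variable {n d : ℕ} {M : Matroid (J n)} {𝓕 𝓖 𝓣 : Set (Set (J n))} {F G : Set (J n)}

lemma isFlag_iff : IsFlag M 𝓕 ↔ AdmChain 𝓕 ∧ ∀ F ∈ 𝓕, M.IsFlat F := by
  refine ⟨fun h => ?_, fun ⟨h, hflat⟩ => ⟨fun F hF => ?_, h.chain⟩⟩
  · have hmem (F) (hF : F ∈ 𝓕) : M.IsFlat F ∧ IsAdmissible F :=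
      (h.1 hF).1.resolve_right fun huniv => (h.1 hF).2 (.inr huniv)
    exact ⟨⟨fun F hF => nonempty_iff_ne_empty.2 fun hemp => (h.1 hF).2 (.inl hemp),
      fun F hF => (hmem F hF).2, h.2⟩, fun F hF => (hmem F hF).1⟩
  · have hne := h.nonempty F hF
    exact ⟨.inl ⟨hflat F hF, h.admissible F hF⟩, not_or.2 ⟨hne.ne_empty,
      (h.admissible F hF).ne_univ hne.some_mem⟩⟩

lemma isFlag_empty : IsFlag M ∅ := ⟨empty_subset _, Set.pairwise_empty _⟩

namespace IsFlag

lemma admChain (h : IsFlag M 𝓕) : AdmChain 𝓕 := (isFlag_iff.1 h).1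

lemma isFlat (h : IsFlag M 𝓕) (hF : F ∈ 𝓕) : M.IsFlat F := (isFlag_iff.1 h).2 F hF

lemma admissible (h : IsFlag M 𝓕) (hF : F ∈ 𝓕) : IsAdmissible F := h.admChain.admissible F hF

lemma mono (h : IsFlag M 𝓖) (hs : 𝓕 ⊆ 𝓖) : IsFlag M 𝓕 := ⟨hs.trans h.1, h.2.mono hs⟩

lemma insert_flat (h : IsFlag M 𝓕) (hG : M.IsFlat G) (hadm : IsAdmissible G)
    (hne : G.Nonempty) (hcomp : ∀ T ∈ 𝓕, T ⊆ G ∨ G ⊆ T) : IsFlag M (insert G 𝓕) := by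
  refine isFlag_iff.2 ⟨⟨?_, ?_, h.2.insert fun T hT _ => (hcomp T hT).symm⟩, ?_⟩
  · exact forall_mem_insert.2 ⟨hne, h.admChain.nonempty⟩
  · exact forall_mem_insert.2 ⟨hadm, h.admChain.admissible⟩
  · exact forall_mem_insert.2 ⟨hG, fun _ => h.isFlat⟩

end IsFlag

/-- The flats that extend the flag `𝓣` by one member; they index the cones around the cone of
`𝓣`. -/
noncomputable def extFlats (M : Matroid (J n)) (𝓣 : Set (Set (J n))) : Finset (Set (J n)) :=
  (toFinite {G | G ∉ 𝓣 ∧ IsFlag M (insert G 𝓣)}).toFinset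

lemma mem_extFlats : G ∈ extFlats M 𝓣 ↔ G ∉ 𝓣 ∧ IsFlag M (insert G 𝓣) := by simp [extFlats]

/-- A complete flag: its cone is one of the `d`-dimensional cones of the Bergman fan. -/
structure IsCompleteFlag (M : Matroid (J n)) (d : ℕ) (𝓕 : Set (Set (J n))) : Prop where
  isFlag : IsFlag M 𝓕
  ncard_eq : 𝓕.ncard = d

lemma isCompleteFlag_insert (hcard : 𝓣.ncard + 1 = d) (hG : G ∈ extFlats M 𝓣) :
    IsCompleteFlag M d (insert G 𝓣) :=
  ⟨(mem_extFlats.1 hG).2, by rw [ncard_insert_of_notMem (mem_extFlats.1 hG).1, hcard]⟩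

/-- The cone of a complete flag, as an element of the set of `d`-dimensional cones. -/
def IsCompleteFlag.cone (h : IsCompleteFlag M d 𝓕) : conesOfDim (bergmanFan M) d :=
  ⟨flagCone 𝓕, ⟨𝓕, h.isFlag, rfl⟩, h.isFlag.admChain.coneDim_flagCone.trans h.ncard_eq⟩

lemma exists_completeFlag (σ : conesOfDim (bergmanFan M) d) :
    ∃ (𝓕 : Set (Set (J n))) (h : IsCompleteFlag M d 𝓕), h.cone = σ := by
  obtain ⟨_, ⟨𝓕, h𝓕, rfl⟩, hdim⟩ := σ
  exact ⟨𝓕, ⟨h𝓕, (IsFlag.admChain h𝓕).coneDim_flagCone.symm.trans hdim⟩, rfl⟩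

lemma IsCompleteFlag.isTopFlat_cone_iff (h : IsCompleteFlag M d 𝓕) :
    IsTopFlat M h.cone.1 F ↔ IsGreatest 𝓕 F := by
  refine ⟨?_, fun hF => ⟨𝓕, h.isFlag, rfl, hF⟩⟩
  rintro ⟨𝓖, h𝓖, hcone, hF⟩
  rwa [(h𝓖.admChain.flagCone_inj h.isFlag.admChain).1 hcone] at hF

lemma exists_extFlat_of_le (h𝓣 : IsFlag M 𝓣) (hcard : 𝓣.ncard + 1 = d)
    (σ : conesOfDim (bergmanFan M) d) (hle : flagCone 𝓣 ≤ σ.1) :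
    ∃ (G : Set (J n)) (hG : G ∈ extFlats M 𝓣), (isCompleteFlag_insert hcard hG).cone = σ := by
  obtain ⟨𝓕, h𝓕, rfl⟩ := exists_completeFlag σ
  obtain ⟨G, hG, rfl⟩ := (exists_eq_insert_iff_ncard (toFinite 𝓣)).2
    ⟨(h𝓣.admChain.flagCone_le_iff h𝓕.isFlag.admChain).1 hle, hcard.trans h𝓕.ncard_eq.symm⟩
  exact ⟨G, mem_extFlats.2 ⟨hG, h𝓕.isFlag⟩, rfl⟩

open Classical in
/-- A weight on the `d`-dimensional cones as a function of the flag, with value `0` on flags that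
are not complete. -/
noncomputable def flagWeight (c : conesOfDim (bergmanFan M) d → ℤ) (𝓕 : Set (Set (J n))) : ℤ :=
  if h : IsCompleteFlag M d 𝓕 then c h.cone else 0

lemma IsCompleteFlag.flagWeight_eq (h : IsCompleteFlag M d 𝓕)
    (c : conesOfDim (bergmanFan M) d → ℤ) : flagWeight c 𝓕 = c h.cone := dif_pos h

/-- The balancing condition on a function of the complete flags, with `signedVec G` as the normal
vector of the cone of `insert G 𝓣` along the cone of `𝓣`. -/
def Balanced (M : Matroid (J n)) (d : ℕ) (f : Set (Set (J n)) → ℤ) : Prop :=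
  ∀ 𝓣, IsFlag M 𝓣 → 𝓣.ncard + 1 = d →
    ∑ G ∈ extFlats M 𝓣, f (insert G 𝓣) • signedVec G ∈ linSpan (flagCone 𝓣)

/-- Extending flats correspond bijectively to the `d`-dimensional cones around the cone of `𝓣`. -/
lemma finsum_cones_eq_sum_extFlats {A : Type*} [AddCommMonoid A] (h𝓣 : IsFlag M 𝓣)
    (hcard : 𝓣.ncard + 1 = d)
    (w : {σ : conesOfDim (bergmanFan M) d // flagCone 𝓣 ≤ σ.1} → A) :
    ∑ᶠ σ, w σ = ∑ G : extFlats M 𝓣,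
      w ⟨(isCompleteFlag_insert hcard G.2).cone, flagCone_mono (subset_insert _ _)⟩ := by
  rw [← finsum_eq_sum_of_fintype]
  let cone (G : extFlats M 𝓣) : {σ : conesOfDim (bergmanFan M) d // flagCone 𝓣 ≤ σ.1} :=
    ⟨(isCompleteFlag_insert hcard G.2).cone, flagCone_mono (subset_insert _ _)⟩
  refine (finsum_eq_of_bijective cone ⟨fun G G' h => ?_, fun ⟨σ, hσ⟩ => ?_⟩ fun _ => rfl).symm
  · have hG := mem_extFlats.1 G.2
    have hcone : flagCone (insert G.1 𝓣) = flagCone (insert G'.1 𝓣) := congrArg (·.1.1) h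
    have hins := (hG.2.admChain.flagCone_inj (mem_extFlats.1 G'.2).2.admChain).1 hcone
    exact Subtype.ext ((hins ▸ mem_insert G.1 𝓣 : G.1 ∈ insert G'.1 𝓣).resolve_right hG.1)
  · obtain ⟨G, hG, rfl⟩ := exists_extFlat_of_le h𝓣 hcard σ hσ
    exact ⟨⟨G, hG⟩, rfl⟩

lemma finsum_normalVector_mem_iff (c : conesOfDim (bergmanFan M) d → ℤ) (h𝓣 : IsFlag M 𝓣)
    (hcard : 𝓣.ncard + 1 = d)
    {e : {σ : conesOfDim (bergmanFan M) d // flagCone 𝓣 ≤ σ.1} → (Fin n → ℝ)}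
    (he : ∀ σ, IsNormalVector σ.1.1 (flagCone 𝓣) (e σ)) :
    ∑ᶠ σ, c σ.1 • e σ ∈ linSpan (flagCone 𝓣) ↔
      ∑ G ∈ extFlats M 𝓣, flagWeight c (insert G 𝓣) • signedVec G ∈ linSpan (flagCone 𝓣) := by
  rw [finsum_cones_eq_sum_extFlats h𝓣 hcard, ← Finset.sum_coe_sort (extFlats M 𝓣)]
  have hsub : ∑ G : extFlats M 𝓣, c (isCompleteFlag_insert hcard G.2).cone •
        e ⟨(isCompleteFlag_insert hcard G.2).cone, flagCone_mono (subset_insert _ _)⟩ -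
      ∑ G : extFlats M 𝓣, flagWeight c (insert G.1 𝓣) • signedVec G.1 ∈
        linSpan (flagCone 𝓣) := by
    rw [← Finset.sum_sub_distrib]
    refine sum_mem fun G _ => ?_
    have hG := mem_extFlats.1 G.2
    have hv := he ⟨(isCompleteFlag_insert hcard G.2).cone, flagCone_mono (subset_insert _ _)⟩
    rw [(isCompleteFlag_insert hcard G.2).flagWeight_eq c, ← smul_sub]
    exact zsmul_mem (hG.2.admChain.sub_mem_of_isNormalVector hG.1 hv) _
  exact ⟨fun h => (Submodule.sub_mem_iff_right _ h).1 hsub,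
    fun h => (Submodule.sub_mem_iff_left _ h).1 hsub⟩

theorem isMinkowskiWeight_iff_balanced (c : conesOfDim (bergmanFan M) d → ℤ) :
    IsMinkowskiWeight (bergmanFan M) d c ↔ Balanced M d (flagWeight c) := by
  constructor
  · intro h 𝓣 h𝓣 hcard
    obtain ⟨e, he, hsum⟩ := h (flagCone 𝓣) ⟨𝓣, h𝓣, rfl⟩
      (by rw [h𝓣.admChain.coneDim_flagCone, hcard])
    exact (finsum_normalVector_mem_iff c h𝓣 hcard he).1 hsum
  · rintro h _ ⟨𝓣, h𝓣, rfl⟩ hdim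
    rw [(IsFlag.admChain h𝓣).coneDim_flagCone] at hdim
    have hex : ∀ σ : {σ : conesOfDim (bergmanFan M) d // flagCone 𝓣 ≤ σ.1},
        ∃ v, IsNormalVector σ.1.1 (flagCone 𝓣) v := by
      rintro ⟨σ, hσ⟩
      obtain ⟨G, hG, rfl⟩ := exists_extFlat_of_le h𝓣 hdim σ hσ
      have hG' := mem_extFlats.1 hG
      exact ⟨signedVec G, hG'.2.admChain.isNormalVector_signedVec hG'.1⟩
    choose e he using hex
    exact ⟨e, he, (finsum_normalVector_mem_iff c h𝓣 hdim he).2 (h 𝓣 h𝓣 hdim)⟩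

end Flags

section Gap

variable {n d r : ℕ} {M : Matroid (J n)} {𝓕 𝓣 : Set (Set (J n))} {F G H T : Set (J n)} {a : J n}

namespace IsFlag

lemma isFlat_of_mem_insert_empty (hM : IsAdmissibleMatroid M) (h : IsFlag M 𝓕)
    (hF : F ∈ insert ∅ 𝓕) : M.IsFlat F := by
  rcases hF with rfl | hF
  exacts [hM.isFlat_empty, h.isFlat hF]

lemma subset_of_rk_le (hM : IsAdmissibleMatroid M) (h : IsFlag M 𝓕)
    (hF : F ∈ insert ∅ 𝓕) (hG : G ∈ insert ∅ 𝓕) (hr : rk M F ≤ rk M G) : F ⊆ G := by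
  have hchain : IsChain (· ⊆ ·) (insert ∅ 𝓕) := h.2.insert fun _ _ _ => .inl (empty_subset _)
  refine (hchain.total hF hG).elim id fun hGF => ?_
  exact (eq_of_isFlat_of_rk_le (h.isFlat_of_mem_insert_empty hM hG)
    (h.isFlat_of_mem_insert_empty hM hF) hGF hr).ge

lemma injOn_rk (hM : IsAdmissibleMatroid M) (h : IsFlag M 𝓕) : InjOn (rk M) 𝓕 :=
  fun _ hF _ hG hr => (h.subset_of_rk_le hM (.inr hF) (.inr hG) hr.le).antisymm
    (h.subset_of_rk_le hM (.inr hG) (.inr hF) hr.ge)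

lemma rk_pos (hM : IsAdmissibleMatroid M) (h : IsFlag M 𝓕) (hF : F ∈ 𝓕) : 0 < rk M F := by
  by_contra! hr
  have hsub := h.subset_of_rk_le hM (.inr hF) (.inl rfl) (hr.trans (Nat.zero_le _))
  exact (h.admChain.nonempty F hF).ne_empty (subset_empty_iff.1 hsub)

lemma rk_le (hM : IsAdmissibleMatroid M) (hr : rk M univ = d + 1) (h : IsFlag M 𝓕)
    (hF : F ∈ 𝓕) : rk M F ≤ d :=
  hM.rk_le_of_admissible hr (h.isFlat hF) (h.admissible hF)

lemma exists_least_above (h : IsFlag M 𝓕) (hF : F ∈ insert ∅ 𝓕)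
    (hex : ∃ T ∈ 𝓕, ¬ T ⊆ F) : ∃ H ∈ 𝓕, F ⊂ H ∧ ∀ T ∈ 𝓕, T ⊆ F ∨ H ⊆ T := by
  obtain ⟨T, hT, hTF⟩ := hex
  obtain ⟨H, ⟨hH, hHF⟩, hmin⟩ := exists_isLeast_of_isChain
    (h.2.mono (sep_subset 𝓕 fun T => ¬ T ⊆ F)) ⟨T, hT, hTF⟩
  refine ⟨H, hH, ?_, fun T hT => or_iff_not_imp_left.2 fun hTF => hmin ⟨hT, hTF⟩⟩
  rcases hF with rfl | hF
  · exact empty_ssubset.2 (h.admChain.nonempty H hH)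
  · exact ((h.2.total hF hH).resolve_right hHF).ssubset_of_not_subset hHF

lemma image_rk_subset_Icc (hM : IsAdmissibleMatroid M) (h : IsFlag M 𝓕)
    (hle : ∀ F ∈ 𝓕, rk M F ≤ r) : rk M '' 𝓕 ⊆ Icc 1 r :=
  image_subset_iff.2 fun F hF => ⟨h.rk_pos hM hF, hle F hF⟩

lemma ncard_le (hM : IsAdmissibleMatroid M) (h : IsFlag M 𝓕) (hle : ∀ F ∈ 𝓕, rk M F ≤ r) :
    𝓕.ncard ≤ r := by
  have := ncard_le_ncard (h.image_rk_subset_Icc hM hle)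
  rwa [(h.injOn_rk hM).ncard_image, ncard_Icc_nat, Nat.add_sub_cancel] at this

lemma image_rk_eq_Icc (hM : IsAdmissibleMatroid M) (h : IsFlag M 𝓕) (hle : ∀ F ∈ 𝓕, rk M F ≤ r)
    (hcard : 𝓕.ncard = r) : rk M '' 𝓕 = Icc 1 r := by
  refine eq_of_subset_of_ncard_le (h.image_rk_subset_Icc hM hle) ?_
  rw [(h.injOn_rk hM).ncard_image, hcard, ncard_Icc_nat, Nat.add_sub_cancel]

lemma exists_rk_gap (hM : IsAdmissibleMatroid M) (h : IsFlag M 𝓕) (hcard : 𝓕.ncard < r) :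
    ∃ F ∈ insert ∅ 𝓕, rk M F < r ∧ ∀ T ∈ 𝓕, rk M T ≠ rk M F + 1 := by
  by_contra! hsucc
  have hall : ∀ k ≤ r, ∃ F ∈ insert ∅ 𝓕, rk M F = k := fun k hk => by
    induction k with
    | zero => exact ⟨∅, .inl rfl, rk_empty⟩
    | succ k ih =>
      obtain ⟨F, hF, rfl⟩ := ih (by omega)
      obtain ⟨T, hT, hTF⟩ := hsucc F hF hk
      exact ⟨T, .inr hT, hTF⟩
  have hsub : Icc 1 r ⊆ rk M '' 𝓕 := fun k hk => by
    obtain ⟨F, rfl | hF, rfl⟩ := hall k hk.2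
    · simp [rk_empty] at hk
    · exact ⟨F, hF, rfl⟩
  have := ncard_le_ncard hsub
  rw [(h.injOn_rk hM).ncard_image, ncard_Icc_nat, Nat.add_sub_cancel] at this
  omega

/-- Of the flags below `F` that contain `𝓣` take a maximal one. A rank that it misses could be
filled, just below its next member, by a flat generated by one more element. -/
lemma exists_completion (hM : IsAdmissibleMatroid M) (h : IsFlag M 𝓣) (hF : M.IsFlat F)
    (hadm : IsAdmissible F) (hTF : ∀ T ∈ 𝓣, T ⊆ F) :
    ∃ 𝓗, 𝓣 ⊆ 𝓗 ∧ IsFlag M 𝓗 ∧ 𝓗.ncard = rk M F ∧ F ∈ insert ∅ 𝓗 ∧ ∀ T ∈ 𝓗, T ⊆ F := by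
  obtain ⟨𝓗, h𝓣𝓗, ⟨h𝓗, hle⟩, hmax⟩ :=
    (toFinite {𝓗 | IsFlag M 𝓗 ∧ ∀ T ∈ 𝓗, T ⊆ F}).exists_le_maximal ⟨h, hTF⟩
  have hfill : ∀ G, IsFlag M (insert G 𝓗) → G ⊆ F → G ∈ 𝓗 := fun G hG hGF =>
    hmax ⟨hG, forall_mem_insert.2 ⟨hGF, hle⟩⟩ (subset_insert _ _) (mem_insert _ _)
  have hFmem : F ∈ insert ∅ 𝓗 := F.eq_empty_or_nonempty.imp_right fun hne =>
    hfill F (h𝓗.insert_flat hF hadm hne fun T hT => .inl (hle T hT)) subset_rfl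
  refine ⟨𝓗, h𝓣𝓗, h𝓗, (h𝓗.ncard_le hM fun T hT => rk_mono (hle T hT)).antisymm ?_, hFmem, hle⟩
  by_contra! hlt
  obtain ⟨L, hL, hLr, hgap⟩ := h𝓗.exists_rk_gap hM hlt
  have hF𝓗 : F ∈ 𝓗 := hFmem.resolve_left fun hemp => by simp [hemp, rk_empty] at hLr
  obtain ⟨H, hH, hLH, hleast⟩ := h𝓗.exists_least_above hL ⟨F, hF𝓗, fun hFL =>
    hLr.not_ge (rk_mono hFL)⟩
  obtain ⟨a, haH, haL⟩ := exists_of_ssubset hLH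
  have hLC : insert a L ⊆ M.closure (insert a L) := hM.subset_closure _
  have hCH : M.closure (insert a L) ⊆ H :=
    closure_subset_of_isFlat (h𝓗.isFlat hH) (insert_subset haH hLH.subset)
  refine hgap (M.closure (insert a L)) (hfill _ (h𝓗.insert_flat (M.isFlat_closure _)
    ((h𝓗.admissible hH).subset hCH) ⟨a, hLC (mem_insert _ _)⟩ fun T hT => ?_)
    (hCH.trans (hle H hH))) ?_
  · exact (hleast T hT).imp (·.trans ((subset_insert _ _).trans hLC)) hCH.trans
  · rw [rk_closure,
      rk_insert_of_isFlat (h𝓗.isFlat_of_mem_insert_empty hM hL) (hM.mem_ground a) haL]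

end IsFlag

/-- The gap of a flag `𝓣` with one member fewer than a complete flag lies just above `F`: the flats
that extend `𝓣` are of rank `rk M F + 1`. The first possible gap lies above `F = ∅`, which is not a
member of `𝓣`. -/
structure IsGap (M : Matroid (J n)) (𝓣 : Set (Set (J n))) (F : Set (J n)) : Prop where
  isFlag : IsFlag M 𝓣
  isFlat : M.IsFlat F
  mem : F ∈ insert ∅ 𝓣
  rk_ne : ∀ T ∈ 𝓣, rk M T ≠ rk M F + 1
  rk_eq : ∀ G ∈ extFlats M 𝓣, rk M G = rk M F + 1

lemma IsCompleteFlag.exists_rk_eq (hM : IsAdmissibleMatroid M) (hr : rk M univ = d + 1)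
    (h : IsCompleteFlag M d 𝓕) (hrd : r ∈ Icc 1 d) : ∃ F ∈ 𝓕, rk M F = r :=
  (h.isFlag.image_rk_eq_Icc hM (fun _ => h.isFlag.rk_le hM hr) h.ncard_eq).ge hrd

lemma IsFlag.exists_gap (hM : IsAdmissibleMatroid M) (hr : rk M univ = d + 1) (h : IsFlag M 𝓣)
    (hcard : 𝓣.ncard + 1 = d) : ∃ F, IsGap M 𝓣 F := by
  obtain ⟨F, hF, hFd, hne⟩ := h.exists_rk_gap hM (Nat.lt_of_succ_le hcard.le)
  refine ⟨F, h, h.isFlat_of_mem_insert_empty hM hF, hF, hne, fun G hG => ?_⟩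
  obtain ⟨T, rfl | hT, hTr⟩ := (isCompleteFlag_insert hcard hG).exists_rk_eq hM hr
    (⟨Nat.le_add_left 1 (rk M F), hFd⟩ : rk M F + 1 ∈ Icc 1 d)
  exacts [hTr, (hne T hT hTr).elim]

lemma isFlat_of_mem_extFlats (hG : G ∈ extFlats M 𝓣) : M.IsFlat G :=
  (mem_extFlats.1 hG).2.isFlat (mem_insert _ _)

lemma admissible_of_mem_extFlats (hG : G ∈ extFlats M 𝓣) : IsAdmissible G :=
  (mem_extFlats.1 hG).2.admissible (mem_insert _ _)

namespace IsGap

lemma admissible (h : IsGap M 𝓣 F) : IsAdmissible F := by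
  rcases h.mem with rfl | hF
  exacts [isAdmissible_iff.2 fun _ => False.elim, h.isFlag.admissible hF]

lemma mem_extFlats (h : IsGap M 𝓣 F) (hG : M.IsFlat G) (hadm : IsAdmissible G)
    (hr : rk M G = rk M F + 1) (hcomp : ∀ T ∈ 𝓣, T ⊆ G ∨ G ⊆ T) : G ∈ extFlats M 𝓣 := by
  refine RankedSymplectic.mem_extFlats.2 ⟨fun hmem => h.rk_ne G hmem hr, ?_⟩
  refine h.isFlag.insert_flat hG hadm (nonempty_iff_ne_empty.2 ?_) hcomp
  rintro rfl
  simp [rk_empty] at hr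

lemma subset (hM : IsAdmissibleMatroid M) (h : IsGap M 𝓣 F) (hG : G ∈ extFlats M 𝓣) : F ⊆ G := by
  have hFG : F ∈ insert ∅ (insert G 𝓣) := insert_subset_insert (subset_insert _ _) h.mem
  refine (RankedSymplectic.mem_extFlats.1 hG).2.subset_of_rk_le hM hFG (.inr (mem_insert _ _)) ?_
  exact h.rk_eq G hG ▸ Nat.le_succ _

lemma subset_or_subset (hM : IsAdmissibleMatroid M) (h : IsGap M 𝓣 F) (hG : G ∈ extFlats M 𝓣)
    (hT : T ∈ 𝓣) : T ⊆ F ∨ G ⊆ T := by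
  rcases (h.rk_ne T hT).lt_or_gt with hlt | hgt
  · exact .inl (h.isFlag.subset_of_rk_le hM (.inr hT) h.mem (Nat.le_of_lt_succ hlt))
  · refine .inr ((RankedSymplectic.mem_extFlats.1 hG).2.subset_of_rk_le hM
      (.inr (mem_insert _ _)) (.inr (.inr hT)) ?_)
    exact h.rk_eq G hG ▸ hgt.le

lemma exists_mem (h : IsGap M 𝓣 F) (hG : G ∈ extFlats M 𝓣) : ∃ a ∈ G, a ∉ F :=
  not_subset.1 fun hGF => by
    have := rk_mono (M := M) hGF
    have := h.rk_eq G hG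
    omega

lemma closure_insert_eq (hM : IsAdmissibleMatroid M) (h : IsGap M 𝓣 F) (hG : G ∈ extFlats M 𝓣)
    (ha : a ∈ G) (haF : a ∉ F) : M.closure (insert a F) = G :=
  closure_insert_eq_of_rk_le (isFlat_of_mem_extFlats hG) (h.subset hM hG) ha
    (by rwa [h.isFlat.closure]) (h.rk_eq G hG).le

lemma closure_insert_mem_extFlats (hM : IsAdmissibleMatroid M) (h : IsGap M 𝓣 F) (haF : a ∉ F)
    (hadm : IsAdmissible (M.closure (insert a F)))
    (hcomp : ∀ T ∈ 𝓣, T ⊆ F ∨ insert a F ⊆ T) : M.closure (insert a F) ∈ extFlats M 𝓣 := by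
  refine h.mem_extFlats (M.isFlat_closure _) hadm ?_ fun T hT => (hcomp T hT).imp ?_ ?_
  · rw [rk_closure, rk_insert_of_isFlat h.isFlat (hM.mem_ground a) haF]
  · exact fun hTF => hTF.trans ((subset_insert _ _).trans (hM.subset_closure _))
  · exact closure_subset_of_isFlat (h.isFlag.isFlat hT)

lemma signedVec_mem_linSpan (h : IsGap M 𝓣 F) : signedVec F ∈ linSpan (flagCone 𝓣) := by
  rcases h.mem with rfl | hF
  · exact signedVec_empty ▸ zero_mem _
  · exact RankedSymplectic.signedVec_mem_linSpan hF

end IsGap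

end Gap

section Balancing

variable {n d : ℕ} {M : Matroid (J n)} {𝓣 : Set (Set (J n))} {F G G' H : Set (J n)} {a b : J n}
  {s : Finset (Set (J n))} {g : Set (J n) → ℤ}

open Classical in
/-- The total weight of the members of `s` that contain `a`: the coefficient of `signedUnit a` in
the weighted sum of the vectors of the members of `s`. -/
noncomputable def coverWeight (s : Finset (Set (J n))) (g : Set (J n) → ℤ) (a : J n) : ℤ :=
  ∑ G ∈ s with a ∈ G, g G

lemma coverWeight_eq_zero (h : ∀ G ∈ s, a ∉ G) : coverWeight s g a = 0 := by
  classical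
  exact Finset.sum_eq_zero fun G hG =>
    (h G (Finset.mem_filter.1 hG).1 (Finset.mem_filter.1 hG).2).elim

lemma coverWeight_eq_sum (h : ∀ G ∈ s, a ∈ G) : coverWeight s g a = ∑ G ∈ s, g G := by
  classical
  exact Finset.sum_congr (Finset.filter_true_of_mem h) fun _ _ => rfl

lemma coord_sum_smul_signedVec (s : Finset (Set (J n))) (g : Set (J n) → ℤ) (a : J n) :
    coord a (∑ G ∈ s, g G • signedVec G) = coverWeight s g a - coverWeight s g (star a) := by
  simp only [coverWeight, Finset.sum_filter, map_sum, map_zsmul, coord_signedVec]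
  push_cast
  rw [← Finset.sum_sub_distrib]
  refine Finset.sum_congr rfl fun G _ => ?_
  split_ifs <;> simp

namespace IsGap

lemma coverWeight_eq (hM : IsAdmissibleMatroid M) (h : IsGap M 𝓣 F) (hG : G ∈ extFlats M 𝓣)
    (ha : a ∈ G) (haF : a ∉ F) : coverWeight (extFlats M 𝓣) g a = g G := by
  classical
  refine Finset.sum_eq_single_of_mem G (by simp [hG, ha]) fun G' hG' hne => (hne ?_).elim
  rw [Finset.mem_filter] at hG'
  rw [← h.closure_insert_eq hM hG'.1 hG'.2 haF, h.closure_insert_eq hM hG ha haF]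

/-- If all members of the flag lie below the gap, the extending flats are the rank one extensions
of `F`, and they come in pairs: `a` and `a*` generate admissible flats over `F` together. -/
lemma sum_mem_linSpan_of_star (hM : IsAdmissibleMatroid M) (h : IsGap M 𝓣 F)
    (htop : ∀ T ∈ 𝓣, T ⊆ F)
    (hg : ∀ G ∈ extFlats M 𝓣, ∀ G' ∈ extFlats M 𝓣, ∀ a ∈ G, star a ∈ G' → g G = g G') :
    ∑ G ∈ extFlats M 𝓣, g G • signedVec G ∈ linSpan (flagCone 𝓣) := by
  set s := extFlats M 𝓣
  suffices hsum : ∑ G ∈ s, g G • signedVec G = (∑ G ∈ s, g G) • signedVec F from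
    hsum ▸ zsmul_mem h.signedVec_mem_linSpan _
  have hpair : ∀ a ∉ F, star a ∉ F → ∀ G ∈ s, a ∈ G →
      coverWeight s g a = coverWeight s g (star a) := fun a haF haF' G hG ha => by
    have hcl := h.closure_insert_eq hM hG ha haF
    have hG' := h.closure_insert_mem_extFlats hM haF' (hM.admissible_closure_insert_star
      (hcl ▸ admissible_of_mem_extFlats hG) (by rwa [h.isFlat.closure]))
      fun T hT => .inl (htop T hT)
    have ha' := hM.subset_closure _ (mem_insert (star a) F)
    rw [h.coverWeight_eq hM hG ha haF, h.coverWeight_eq hM hG' ha' haF', hg G hG _ hG' a ha ha']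
  have hmem : ∀ a ∈ F, coverWeight s g a = ∑ G ∈ s, g G ∧ coverWeight s g (star a) = 0 :=
    fun a ha => ⟨coverWeight_eq_sum fun G hG => h.subset hM hG ha, coverWeight_eq_zero fun G hG =>
      (admissible_of_mem_extFlats hG).star_notMem (h.subset hM hG ha)⟩
  refine eq_of_coord_eq fun a => ?_
  rw [coord_sum_smul_signedVec, map_zsmul]
  by_cases ha : a ∈ F
  · simp [hmem a ha, coord_signedVec_of_mem h.admissible ha]
  by_cases ha' : star a ∈ F
  · have hstar := hmem _ ha'
    rw [star_star] at hstar
    rw [← neg_eq_iff_eq_neg.2 (coord_star a _), coord_signedVec_of_mem h.admissible ha']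
    simp [hstar]
  have hbal : coverWeight s g a = coverWeight s g (star a) := by
    by_cases hcov : ∃ G ∈ s, a ∈ G ∨ star a ∈ G
    · obtain ⟨G, hG, haG | haG⟩ := hcov
      · exact hpair a ha ha' G hG haG
      · simpa using (hpair _ ha' (by simpa using ha) G hG haG).symm
    · push Not at hcov
      rw [coverWeight_eq_zero fun G hG => (hcov G hG).1,
        coverWeight_eq_zero fun G hG => (hcov G hG).2]
  rw [hbal, sub_self, coord_signedVec_of_notMem ha ha', smul_zero]

lemma eq_of_star_mem (hM : IsAdmissibleMatroid M) (h : IsGap M 𝓣 F) (htop : ∀ T ∈ 𝓣, T ⊆ F)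
    (hsum : ∑ G ∈ extFlats M 𝓣, g G • signedVec G ∈ linSpan (flagCone 𝓣))
    (hG : G ∈ extFlats M 𝓣) (hG' : G' ∈ extFlats M 𝓣) (ha : a ∈ G) (ha' : star a ∈ G') :
    g G = g G' := by
  have haF : a ∉ F := fun haF =>
    (admissible_of_mem_extFlats hG').star_notMem (h.subset hM hG' haF) ha'
  have haF' : star a ∉ F := fun haF' =>
    (admissible_of_mem_extFlats hG).star_notMem ha (h.subset hM hG haF')
  have hker : linSpan (flagCone 𝓣) ≤ LinearMap.ker (coord a) := by
    refine linSpan_flagCone_le.2 fun T hT => ?_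
    exact coord_signedVec_of_notMem (fun h => haF (htop T hT h)) fun h => haF' (htop T hT h)
  have hzero := hker hsum
  rw [LinearMap.mem_ker, coord_sum_smul_signedVec, h.coverWeight_eq hM hG ha haF,
    h.coverWeight_eq hM hG' ha' haF', sub_eq_zero] at hzero
  exact_mod_cast hzero

/-- If `H` is the next member of the flag above the gap, the extending flats partition `H \ F`. -/
lemma sum_mem_linSpan_of_const (hM : IsAdmissibleMatroid M) (h : IsGap M 𝓣 F) (hH : H ∈ 𝓣)
    (hFH : F ⊂ H) (hleast : ∀ T ∈ 𝓣, T ⊆ F ∨ H ⊆ T)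
    (hg : ∀ G ∈ extFlats M 𝓣, ∀ G' ∈ extFlats M 𝓣, g G = g G') :
    ∑ G ∈ extFlats M 𝓣, g G • signedVec G ∈ linSpan (flagCone 𝓣) := by
  classical
  have hext : ∀ a ∈ H, a ∉ F → M.closure (insert a F) ∈ extFlats M 𝓣 := fun a ha haF =>
    h.closure_insert_mem_extFlats hM haF
      ((h.isFlag.admissible hH).subset
        (closure_subset_of_isFlat (h.isFlag.isFlat hH) (insert_subset ha hFH.subset)))
      fun T hT => (hleast T hT).imp_right ((insert_subset ha hFH.subset).trans ·)
  have hGH : ∀ G ∈ extFlats M 𝓣, G ⊆ H := fun G hG =>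
    (h.subset_or_subset hM hG hH).resolve_left hFH.not_subset
  obtain ⟨b, hb, hbF⟩ := exists_of_ssubset hFH
  have hG₀ := hext b hb hbF
  set s := extFlats M 𝓣
  set c := g (M.closure (insert b F))
  have hcover : ∀ a, coverWeight s g a =
      (if a ∈ F then ∑ G ∈ s, g G - c else 0) + if a ∈ H then c else 0 := fun a => by
    by_cases haF : a ∈ F
    · rw [coverWeight_eq_sum fun G hG => h.subset hM hG haF, if_pos haF, if_pos (hFH.subset haF)]
      ring
    by_cases haH : a ∈ H
    · rw [h.coverWeight_eq hM (hext a haH haF) (hM.subset_closure _ (mem_insert _ _)) haF,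
        hg _ (hext a haH haF) _ hG₀, if_neg haF, if_pos haH, zero_add]
    · rw [coverWeight_eq_zero fun G hG ha => haH (hGH G hG ha), if_neg haF, if_neg haH, zero_add]
  have hsum : ∑ G ∈ s, g G • signedVec G = (∑ G ∈ s, g G - c) • signedVec F + c • signedVec H := by
    refine eq_of_coord_eq fun a => ?_
    rw [coord_sum_smul_signedVec, map_add, map_zsmul, map_zsmul, coord_signedVec, coord_signedVec,
      hcover, hcover]
    push_cast [zsmul_eq_mul]
    split_ifs <;> ring
  exact hsum ▸ add_mem (zsmul_mem h.signedVec_mem_linSpan _)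
    (zsmul_mem (RankedSymplectic.signedVec_mem_linSpan hH) _)

lemma eq_of_sum_mem_linSpan (hM : IsAdmissibleMatroid M) (h : IsGap M 𝓣 F) (hH : H ∈ 𝓣)
    (hFH : F ⊂ H) (hleast : ∀ T ∈ 𝓣, T ⊆ F ∨ H ⊆ T)
    (hsum : ∑ G ∈ extFlats M 𝓣, g G • signedVec G ∈ linSpan (flagCone 𝓣))
    (hG : G ∈ extFlats M 𝓣) (hG' : G' ∈ extFlats M 𝓣) : g G = g G' := by
  have hGH : ∀ G ∈ extFlats M 𝓣, G ⊆ H := fun G hG =>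
    (h.subset_or_subset hM hG hH).resolve_left hFH.not_subset
  obtain ⟨a, ha, haF⟩ := h.exists_mem hG
  obtain ⟨b, hb, hbF⟩ := h.exists_mem hG'
  have hH_adm := h.isFlag.admissible hH
  have hstar : ∀ {x}, x ∈ H → star x ∉ F := fun hx hx' => hH_adm.star_notMem hx (hFH.subset hx')
  have hker : linSpan (flagCone 𝓣) ≤ LinearMap.ker (coord a - coord b) := by
    refine linSpan_flagCone_le.2 fun T hT => ?_
    refine sub_eq_zero.2 ?_
    rcases hleast T hT with hTF | hHT
    · have hzero : ∀ x ∈ H, x ∉ F → coord x (signedVec T) = 0 := fun x hx hxF =>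
        coord_signedVec_of_notMem (fun h => hxF (hTF h)) fun h => hstar hx (hTF h)
      rw [hzero a (hGH G hG ha) haF, hzero b (hGH G' hG' hb) hbF]
    · have hT_adm := h.isFlag.admissible hT
      rw [coord_signedVec_of_mem hT_adm (hHT (hGH G hG ha)),
        coord_signedVec_of_mem hT_adm (hHT (hGH G' hG' hb))]
  have hcoord : ∀ {G x}, G ∈ extFlats M 𝓣 → x ∈ G → x ∉ F →
      coord x (∑ G ∈ extFlats M 𝓣, g G • signedVec G) = g G := fun {G x} hG hx hxF => by
    rw [coord_sum_smul_signedVec, h.coverWeight_eq hM hG hx hxF, coverWeight_eq_zero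
      fun G' hG' hx' => hH_adm.star_notMem (hGH G hG hx) (hGH G' hG' hx'), Int.cast_zero, sub_zero]
  have heq := sub_eq_zero.1 (hker hsum)
  rw [hcoord hG ha haF, hcoord hG' hb hbF] at heq
  exact_mod_cast heq

end IsGap

/-- The local relation on the flats that extend `𝓣` along which a balanced weight is constant:
either both flats fill an inner gap of `𝓣` or they lie above the whole flag and contain a pair
`a, a*` between them. -/
def Tied (𝓣 : Set (Set (J n))) (G G' : Set (J n)) : Prop :=
  (∃ H ∈ 𝓣, G ⊆ H) ∨ ∃ a ∈ G, star a ∈ G'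

lemma IsGap.sum_mem_linSpan_iff (hM : IsAdmissibleMatroid M) (h : IsGap M 𝓣 F) :
    ∑ G ∈ extFlats M 𝓣, g G • signedVec G ∈ linSpan (flagCone 𝓣) ↔
      ∀ G ∈ extFlats M 𝓣, ∀ G' ∈ extFlats M 𝓣, Tied 𝓣 G G' → g G = g G' := by
  by_cases hex : ∃ T ∈ 𝓣, ¬ T ⊆ F
  · obtain ⟨H, hH, hFH, hleast⟩ := h.isFlag.exists_least_above h.mem hex
    refine ⟨fun hsum G hG G' hG' _ => h.eq_of_sum_mem_linSpan hM hH hFH hleast hsum hG hG',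
      fun hg => h.sum_mem_linSpan_of_const hM hH hFH hleast fun G hG G' hG' => ?_⟩
    exact hg G hG G' hG'
      (.inl ⟨H, hH, (h.subset_or_subset hM hG hH).resolve_left hFH.not_subset⟩)
  · push Not at hex
    refine ⟨fun hsum G hG G' hG' htied => ?_, fun hg => h.sum_mem_linSpan_of_star hM hex
      fun G hG G' hG' a ha ha' => hg G hG G' hG' (.inr ⟨a, ha, ha'⟩)⟩
    obtain ⟨T, hT, hGT⟩ | ⟨a, ha, ha'⟩ := htied
    · obtain ⟨b, hb, hbF⟩ := h.exists_mem hG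
      exact (hbF (hex T hT (hGT hb))).elim
    · exact h.eq_of_star_mem hM hex hsum hG hG' ha ha'

theorem balanced_iff (hM : IsAdmissibleMatroid M) (hr : rk M univ = d + 1)
    {f : Set (Set (J n)) → ℤ} :
    Balanced M d f ↔ ∀ 𝓣, IsFlag M 𝓣 → 𝓣.ncard + 1 = d → ∀ G ∈ extFlats M 𝓣,
      ∀ G' ∈ extFlats M 𝓣, Tied 𝓣 G G' → f (insert G 𝓣) = f (insert G' 𝓣) := by
  refine forall₃_congr fun 𝓣 h𝓣 hcard => ?_
  obtain ⟨F, hF⟩ := h𝓣.exists_gap hM hr hcard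
  exact hF.sum_mem_linSpan_iff (g := fun G => f (insert G 𝓣)) hM

end Balancing

section TopWeight

variable {n d s : ℕ} {M : Matroid (J n)} {𝓕 𝓖 𝓣 : Set (Set (J n))} {F H K L P Q X : Set (J n)}
  {a : J n} {f : Set (Set (J n)) → ℤ}

lemma IsFlag.isGreatest_of_rk_eq (hM : IsAdmissibleMatroid M) (hr : rk M univ = d + 1)
    (h : IsFlag M 𝓕) (hF : F ∈ 𝓕) (hFr : rk M F = d) : IsGreatest 𝓕 F :=
  ⟨hF, fun _ hG => h.subset_of_rk_le hM (.inr hG) (.inr hF) (hFr ▸ h.rk_le hM hr hG)⟩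

/-- A member `P` of a flag is exchanged for a flat `Q` of the same rank between its neighbours `L`
and `H` by passing through a flat that covers both. -/
lemma IsFlag.exists_exchange (hM : IsAdmissibleMatroid M) (h : IsFlag M 𝓕) (hH : IsGreatest 𝓕 H)
    (hL : L ∈ insert ∅ 𝓕) (hP : P ∈ 𝓕) (hPr : rk M P = rk M L + 1) (hQ : M.IsFlat Q)
    (hQH : Q ⊆ H) (hLQ : L ⊆ Q) (hQr : rk M Q = rk M P) (hPQ : P ≠ Q) :
    ∃ 𝓣, IsFlag M 𝓣 ∧ 𝓣.ncard + 1 = rk M H ∧ H ∈ 𝓣 ∧ {T ∈ 𝓕 | T ⊆ L} ⊆ 𝓣 ∧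
      P ∈ extFlats M 𝓣 ∧ Q ∈ extFlats M 𝓣 ∧ Tied 𝓣 P Q := by
  have hHmem := hH.1
  have hLflat := h.isFlat_of_mem_insert_empty hM hL
  have hLP : L ⊆ P := h.subset_of_rk_le hM hL (.inr hP) (by omega)
  obtain ⟨K, hK, hPK, hQK, hKH, hKr⟩ := exists_isFlat_covering hLflat (h.isFlat hP) hQ
    (h.isFlat hHmem) hLP hLQ (hH.2 hP) hQH hPr hQr hPQ
  have hHadm := h.admissible hHmem
  have hflag₀ : IsFlag M (insert K {T ∈ 𝓕 | T ⊆ P}) :=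
    (h.mono (sep_subset _ _)).insert_flat hK (hHadm.subset hKH)
      ((h.admChain.nonempty P hP).mono hPK) fun T hT => .inl (hT.2.trans hPK)
  obtain ⟨𝓗, hsub, h𝓗, hcard, hH𝓗, -⟩ := hflag₀.exists_completion hM (h.isFlat hHmem) hHadm
    (forall_mem_insert.2 ⟨hKH, fun T hT => hH.2 hT.1⟩)
  have hK𝓗 : K ∈ 𝓗 := hsub (mem_insert _ _)
  have hP𝓗 : P ∈ 𝓗 := hsub (.inr ⟨hP, subset_rfl⟩)
  have hL𝓗 : L ∈ insert ∅ 𝓗 := hL.imp_right fun hL => hsub (.inr ⟨hL, hLP⟩)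
  have hne : ∀ {T}, rk M T ≠ rk M P → T ≠ P := fun hT h => hT (h ▸ rfl)
  refine ⟨𝓗 \ {P}, h𝓗.mono sdiff_subset, ?_, ⟨?_, ?_⟩, ?_, ?_, ?_, .inl ⟨K, ⟨hK𝓗, ?_⟩, hPK⟩⟩
  · rw [ncard_sdiff_singleton_add_one hP𝓗, hcard]
  · exact hH𝓗.resolve_left fun hemp => (h.admChain.nonempty H hHmem).ne_empty hemp
  · exact hne (by have := rk_mono (M := M) hKH; omega)
  · exact fun T hT => ⟨hsub (.inr ⟨hT.1, hT.2.trans hLP⟩),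
      hne ((rk_mono hT.2).trans_lt (by omega)).ne⟩
  · exact mem_extFlats.2 ⟨fun h => h.2 rfl, by rwa [insert_sdiff_self_of_mem hP𝓗]⟩
  · refine mem_extFlats.2 ⟨fun hQ' => hPQ (h𝓗.injOn_rk hM hP𝓗 hQ'.1 hQr.symm), ?_⟩
    refine (h𝓗.mono sdiff_subset).insert_flat hQ (hHadm.subset hQH)
      (nonempty_iff_ne_empty.2 ?_) fun T hT => ?_
    · rintro rfl
      rw [rk_empty] at hQr
      omega
    · have hTP : rk M T ≠ rk M P := fun hr => hT.2 (h𝓗.injOn_rk hM hT.1 hP𝓗 hr)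
      rcases hTP.lt_or_gt with hlt | hgt
      · exact .inl ((h𝓗.subset_of_rk_le hM (.inr hT.1) hL𝓗 (by omega)).trans hLQ)
      · exact .inr (hQK.trans (h𝓗.subset_of_rk_le hM (.inr hK𝓗) (.inr hT.1) (by omega)))
  · exact hne (by omega)

lemma IsCompleteFlag.rk_eq (hM : IsAdmissibleMatroid M) (hr : rk M univ = d + 1)
    (h : IsCompleteFlag M d 𝓕) (hF : IsGreatest 𝓕 F) : rk M F = d := by
  have hFd := h.isFlag.rk_le hM hr hF.1
  obtain ⟨T, hT, hTr⟩ := h.exists_rk_eq hM hr ⟨(h.isFlag.rk_pos hM hF.1).trans_le hFd, le_rfl⟩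
  exact hFd.antisymm (hTr ▸ rk_mono (hF.2 hT))

lemma IsCompleteFlag.mem_of_rk_le (hM : IsAdmissibleMatroid M) (hr : rk M univ = d + 1)
    (h𝓕 : IsCompleteFlag M d 𝓕) (h𝓖 : IsFlag M 𝓖) (hsub : ∀ T ∈ 𝓕, rk M T ≤ s → T ∈ 𝓖)
    (hF : F ∈ 𝓖) (hFs : rk M F ≤ s) : F ∈ 𝓕 := by
  obtain ⟨T, hT, hTr⟩ := h𝓕.exists_rk_eq hM hr ⟨h𝓖.rk_pos hM hF, h𝓖.rk_le hM hr hF⟩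
  exact h𝓖.injOn_rk hM (hsub T hT (hTr ▸ hFs)) hF hTr ▸ hT

lemma IsCompleteFlag.exists_mem_insert_empty (hM : IsAdmissibleMatroid M)
    (hr : rk M univ = d + 1) (h : IsCompleteFlag M d 𝓕) (hs : s ≤ d) :
    ∃ F ∈ insert ∅ 𝓕, rk M F = s := by
  rcases s.eq_zero_or_pos with rfl | hs0
  · exact ⟨∅, .inl rfl, rk_empty⟩
  · exact (h.exists_rk_eq hM hr ⟨hs0, hs⟩).imp fun _ => .imp_left .inr

lemma IsFlag.agree_succ (hM : IsAdmissibleMatroid M) (h : IsFlag M 𝓕)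
    (hsub : ∀ T ∈ 𝓕, rk M T ≤ s → T ∈ 𝓖) (hP : P ∈ 𝓕) (hPr : rk M P = s + 1) (hP' : P ∈ 𝓖) :
    ∀ T ∈ 𝓕, rk M T ≤ s + 1 → T ∈ 𝓖 := fun T hT hTr => by
  rcases Nat.lt_or_eq_of_le hTr with hlt | heq
  · exact hsub T hT (Nat.le_of_lt_succ hlt)
  · exact h.injOn_rk hM hT hP (heq.trans hPr.symm) ▸ hP'

namespace Balanced

/-- Two complete flags with the same top that agree up to rank `s` are made to agree in rank `s + 1`
by one exchange. -/
lemma eq_of_agree (hM : IsAdmissibleMatroid M) (hr : rk M univ = d + 1) (hf : Balanced M d f)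
    {m : ℕ} (hm : s + m = d) (h𝓕 : IsCompleteFlag M d 𝓕) (h𝓖 : IsCompleteFlag M d 𝓖)
    (hH : IsGreatest 𝓕 H) (hH' : IsGreatest 𝓖 H) (hsub : ∀ T ∈ 𝓕, rk M T ≤ s → T ∈ 𝓖) :
    f 𝓕 = f 𝓖 := by
  induction m generalizing s 𝓕 𝓖 with
  | zero =>
    refine congrArg f (eq_of_subset_of_ncard_le (fun T hT => hsub T hT ?_)
      (h𝓖.ncard_eq.trans h𝓕.ncard_eq.symm).le)
    exact (h𝓕.isFlag.rk_le hM hr hT).trans_eq hm.symm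
  | succ m ih =>
    have hs : s + 1 ∈ Icc 1 d := ⟨by omega, by omega⟩
    obtain ⟨P, hP, hPr⟩ := h𝓕.exists_rk_eq hM hr hs
    obtain ⟨Q, hQ, hQr⟩ := h𝓖.exists_rk_eq hM hr hs
    by_cases hPQ : P = Q
    · exact ih (by omega) h𝓕 h𝓖 hH hH' (h𝓕.isFlag.agree_succ hM hsub hP hPr (hPQ ▸ hQ))
    obtain ⟨L, hL, hLr⟩ := h𝓕.exists_mem_insert_empty hM hr (show s ≤ d by omega)
    have hLQ : L ⊆ Q := h𝓖.isFlag.subset_of_rk_le hM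
      (hL.imp_right fun hL => hsub L hL hLr.le) (.inr hQ) (by omega)
    obtain ⟨𝓣, h𝓣, hcard, hH𝓣, hL𝓣, hP𝓣, hQ𝓣, htied⟩ := h𝓕.isFlag.exists_exchange hM hH hL hP
      (by omega) (h𝓖.isFlag.isFlat hQ) (hH'.2 hQ) hLQ (by omega) hPQ
    have hHd := h𝓕.rk_eq hM hr hH
    rw [hHd] at hcard
    have hle : ∀ T ∈ 𝓕, rk M T ≤ s → T ∈ 𝓣 := fun T hT hTs => hL𝓣
      ⟨hT, h𝓕.isFlag.subset_of_rk_le hM (.inr hT) hL (hTs.trans hLr.ge)⟩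
    have hmove : ∀ {𝓐 : Set (Set (J n))} {R : Set (J n)}, IsCompleteFlag M d 𝓐 →
        IsGreatest 𝓐 H → R ∈ 𝓐 → rk M R = s + 1 → R ∈ extFlats M 𝓣 →
        (∀ T ∈ 𝓐, rk M T ≤ s → T ∈ 𝓣) → f 𝓐 = f (insert R 𝓣) :=
      fun {𝓐 R} h𝓐 hH𝓐 hR hRr hR𝓣 hle => by
        have hins := isCompleteFlag_insert hcard hR𝓣
        have hHins := hins.isFlag.isGreatest_of_rk_eq hM hr (.inr hH𝓣) hHd
        refine ih (s := s + 1) (by omega) h𝓐 hins hH𝓐 hHins ?_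
        exact h𝓐.isFlag.agree_succ hM (fun T hT hTs => .inr (hle T hT hTs)) hR hRr (mem_insert _ _)
    calc f 𝓕 = f (insert P 𝓣) := hmove h𝓕 hH hP hPr hP𝓣 hle
      _ = f (insert Q 𝓣) := (balanced_iff hM hr).1 hf 𝓣 h𝓣 hcard P hP𝓣 Q hQ𝓣 htied
      _ = f 𝓖 := (hmove h𝓖 hH' hQ hQr hQ𝓣 fun T hT hTs =>
        hle T (h𝓕.mem_of_rk_le hM hr h𝓖.isFlag hsub hT hTs) hTs).symm

lemma eq_of_isGreatest (hM : IsAdmissibleMatroid M) (hr : rk M univ = d + 1) (hf : Balanced M d f)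
    (h𝓕 : IsCompleteFlag M d 𝓕) (h𝓖 : IsCompleteFlag M d 𝓖) (hH : IsGreatest 𝓕 H)
    (hH' : IsGreatest 𝓖 H) : f 𝓕 = f 𝓖 :=
  hf.eq_of_agree hM hr (zero_add d) h𝓕 h𝓖 hH hH' fun _ hT hT0 =>
    ((h𝓕.isFlag.rk_pos hM hT).not_ge hT0).elim

end Balanced

open Classical in
/-- The value of a function of the complete flags at a complete flag with largest member `H`. By
`Balanced.topWeight_eq` it does not depend on the choice of the flag if the function is balanced;
it is `0` by convention if there is no such flag. -/
noncomputable def topWeight (M : Matroid (J n)) (d : ℕ) (f : Set (Set (J n)) → ℤ)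
    (H : Set (J n)) : ℤ :=
  if h : ∃ 𝓕, IsCompleteFlag M d 𝓕 ∧ IsGreatest 𝓕 H then f h.choose else 0

namespace Balanced

lemma topWeight_eq (hM : IsAdmissibleMatroid M) (hr : rk M univ = d + 1) (hf : Balanced M d f)
    (h𝓕 : IsCompleteFlag M d 𝓕) (hH : IsGreatest 𝓕 H) : topWeight M d f H = f 𝓕 := by
  have hex : ∃ 𝓕, IsCompleteFlag M d 𝓕 ∧ IsGreatest 𝓕 H := ⟨𝓕, h𝓕, hH⟩
  rw [topWeight, dif_pos hex]
  exact hf.eq_of_isGreatest hM hr hex.choose_spec.1 h𝓕 hex.choose_spec.2 hH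

lemma topWeight_closure_insert_star (hM : IsAdmissibleMatroid M) (hr : rk M univ = d + 1)
    (hf : Balanced M d f) (h : insert a X ∈ indepAd M) (ha : a ∉ X)
    (hcard : (insert a X).ncard = d) :
    topWeight M d f (M.closure (insert a X)) =
      topWeight M d f (M.closure (insert (star a) X)) := by
  have hadm := h.2.subset (M.closure_subset_closure (subset_insert a X))
  obtain ⟨𝓗, -, h𝓗, h𝓗card, -, hle⟩ :=
    isFlag_empty.exists_completion hM (M.isFlat_closure X) hadm (by simp)
  rw [rk_closure, rk_eq_ncard_of_indep (h.1.subset (subset_insert _ _))] at h𝓗card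
  rw [ncard_insert_of_notMem ha, ← h𝓗card] at hcard
  have hext : ∀ b ∉ M.closure X, insert b X ∈ indepAd M → M.closure (insert b X) ∈ extFlats M 𝓗 ∧
      topWeight M d f (M.closure (insert b X)) = f (insert (M.closure (insert b X)) 𝓗) := by
    intro b hb hind
    have hbC := hM.subset_closure _ (mem_insert b X)
    have hsub : ∀ T ∈ 𝓗, T ⊆ M.closure (insert b X) := fun T hT =>
      (hle T hT).trans (M.closure_subset_closure (subset_insert _ _))
    have hC : M.closure (insert b X) ∈ extFlats M 𝓗 := mem_extFlats.2
      ⟨fun hC => hb (hle _ hC hbC),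
        h𝓗.insert_flat (M.isFlat_closure _) hind.2 ⟨b, hbC⟩ fun T hT => .inl (hsub T hT)⟩
    exact ⟨hC, hf.topWeight_eq hM hr (isCompleteFlag_insert hcard hC)
      ⟨mem_insert _ _, forall_mem_insert.2 ⟨subset_rfl, hsub⟩⟩⟩
  have hsa : star a ∉ M.closure X := fun hs => h.2.star_notMem
    (hM.subset_closure _ (mem_insert a X)) (M.closure_subset_closure (subset_insert _ _) hs)
  obtain ⟨hC, hCw⟩ := hext a (notMem_closure_of_indep_insert h.1 ha) h
  obtain ⟨hC', hCw'⟩ := hext (star a) hsa (hM.insert_star_mem_indepAd h ha)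
  rw [hCw, hCw']
  exact (balanced_iff hM hr).1 hf 𝓗 h𝓗 hcard _ hC _ hC' (.inr ⟨a,
    hM.subset_closure _ (mem_insert _ _), hM.subset_closure _ (mem_insert _ _)⟩)

lemma topWeight_closure_eq (hM : IsAdmissibleMatroid M) (hr : rk M univ = d + 1)
    (hf : Balanced M d f) (hF : M.IsFlat F) (hFr : rk M F = d) (hK : K ∈ indepAd M)
    (hKd : K.ncard = d) (hKF : K ⊆ F ∪ starSet F) :
    topWeight M d f (M.closure K) = topWeight M d f F := by
  induction hm : (K \ F).ncard generalizing K with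
  | zero =>
    rw [ncard_eq_zero, sdiff_eq_empty] at hm
    rw [eq_of_isFlat_of_rk_le (M.isFlat_closure K) hF (closure_subset_of_isFlat hF hm)
      (by rw [rk_closure, rk_eq_ncard_of_indep hK.1, hFr, hKd])]
  | succ m ih =>
    obtain ⟨a, haK, haF⟩ := nonempty_of_ncard_ne_zero (hm.trans_ne (Nat.succ_ne_zero m))
    have haF' : star a ∈ F := mem_starSet.1 ((hKF haK).resolve_left haF)
    obtain ⟨X, haX, rfl⟩ : ∃ X, a ∉ X ∧ insert a X = K :=
      ⟨K \ {a}, notMem_sdiff_of_mem rfl, insert_sdiff_self_of_mem haK⟩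
    have hsX : star a ∉ X := fun hs =>
      (hM.admissible_of_mem_indepAd hK).star_notMem haK (.inr hs)
    rw [hf.topWeight_closure_insert_star hM hr hK haX hKd]
    refine ih (hM.insert_star_mem_indepAd hK haX) ?_
      (insert_subset (.inl haF') ((subset_insert _ _).trans hKF)) ?_
    · rw [ncard_insert_of_notMem hsX, ← ncard_insert_of_notMem haX, hKd]
    · rw [insert_sdiff_of_notMem _ haF, ncard_insert_of_notMem (notMem_subset sdiff_subset haX),
        Nat.add_right_cancel_iff] at hm
      rwa [insert_sdiff_of_mem _ haF']

end Balanced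

end TopWeight

section Linked

variable {n d : ℕ} {M : Matroid (J n)} {𝓕 𝓖 𝓣 : Set (Set (J n))} {F G G' : Set (J n)} {b : J n}
  {σ σ' : conesOfDim (bergmanFan M) d} {c : conesOfDim (bergmanFan M) d → ℤ}

lemma Linked.symm (h : Linked M d σ σ') : Linked M d σ' σ := by
  obtain ⟨F, F', hF, hF', hrank⟩ := h
  exact ⟨F', F, hF', hF, inter_comm (F ∪ starSet F) _ ▸ hrank⟩

/-- The common part of `F ∪ F*` and `F' ∪ F'*` contains an admissible basis of a flat of rank `d`,
which is moved to `F` and to `F'` by replacing elements by their images under the involution. -/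
lemma eq_of_linked (hM : IsAdmissibleMatroid M) (hr : rk M univ = d + 1)
    (hc : Balanced M d (flagWeight c)) (h : Linked M d σ σ') : c σ = c σ' := by
  obtain ⟨F, F', hF, hF', hrank⟩ := h
  obtain ⟨𝓕, h𝓕, rfl⟩ := exists_completeFlag σ
  obtain ⟨𝓖, h𝓖, rfl⟩ := exists_completeFlag σ'
  rw [h𝓕.isTopFlat_cone_iff] at hF
  rw [h𝓖.isTopFlat_cone_iff] at hF'
  set A := (F ∪ starSet F) ∩ (F' ∪ starSet F')
  have hA : rk M A = d + 1 := by
    rw [← coe_rk] at hrank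
    exact_mod_cast hrank
  obtain ⟨a, haA, haF⟩ : ∃ a ∈ A, a ∈ F := by
    obtain ⟨a, ha⟩ := nonempty_iff_ne_empty.2 fun hemp : A = ∅ => by simp [hemp, rk_empty] at hA
    refine ha.1.elim (fun haF => ⟨a, ha, haF⟩) fun haF => ⟨star a, ?_, mem_starSet.1 haF⟩
    exact ⟨.inl (mem_starSet.1 haF), ha.2.symm.imp mem_starSet.1 (by simp)⟩
  have ha : {a} ∈ indepAd M := ⟨hM.indep_singleton a, (h𝓕.isFlag.admissible hF.1).subset
    (closure_subset_of_isFlat (h𝓕.isFlag.isFlat hF.1) (singleton_subset_iff.2 haF))⟩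
  obtain ⟨K, hK, hKA, hAK⟩ :=
    hM.exists_indepAd_subset ha (singleton_nonempty a) (singleton_subset_iff.2 haA)
  have hKd : K.ncard = d := by
    have hle := hM.rk_le_of_admissible hr (M.isFlat_closure K) hK.2
    rw [rk_closure, rk_eq_ncard_of_indep hK.1] at hle
    omega
  have htop : ∀ {𝓐 T} (h𝓐 : IsCompleteFlag M d 𝓐), IsGreatest 𝓐 T → K ⊆ T ∪ starSet T →
      topWeight M d (flagWeight c) (M.closure K) = c h𝓐.cone := fun h𝓐 hT hKT => by
    rw [hc.topWeight_closure_eq hM hr (h𝓐.isFlag.isFlat hT.1) (h𝓐.rk_eq hM hr hT) hK hKd hKT,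
      hc.topWeight_eq hM hr h𝓐 hT, h𝓐.flagWeight_eq]
  rw [← htop h𝓕 hF (hKA.trans inter_subset_left), ← htop h𝓖 hF' (hKA.trans inter_subset_right)]

lemma flagWeight_eq_of_isGreatest (hM : IsAdmissibleMatroid M) (hr : rk M univ = d + 1)
    (hc : ∀ σ σ', Linked M d σ σ' → c σ = c σ') (h𝓕 : IsCompleteFlag M d 𝓕)
    (h𝓖 : IsCompleteFlag M d 𝓖) (hG : IsGreatest 𝓕 G) (hG' : IsGreatest 𝓖 G')
    (hb : b ∉ M.closure F) (hF : d ≤ rk M F)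
    (hsub : insert b F ⊆ (G ∪ starSet G) ∩ (G' ∪ starSet G')) :
    flagWeight c 𝓕 = flagWeight c 𝓖 := by
  rw [h𝓕.flagWeight_eq, h𝓖.flagWeight_eq]
  refine hc _ _ ⟨G, G', h𝓕.isTopFlat_cone_iff.2 hG, h𝓖.isTopFlat_cone_iff.2 hG', ?_⟩
  have hle := rk_mono (M := M) hsub
  rw [rk_insert_of_notMem (hM.mem_ground b) hb] at hle
  have hrank := ((rk_mono (subset_univ _)).trans hr.le).antisymm
    ((Nat.succ_le_succ hF).trans hle)
  rw [← coe_rk, hrank, Nat.cast_succ]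

lemma flagWeight_eq_of_tied (hM : IsAdmissibleMatroid M) (hr : rk M univ = d + 1)
    (hc : ∀ σ σ', Linked M d σ σ' → c σ = c σ') (h𝓣 : IsFlag M 𝓣) (hcard : 𝓣.ncard + 1 = d)
    (hG : G ∈ extFlats M 𝓣) (hG' : G' ∈ extFlats M 𝓣) (htied : Tied 𝓣 G G') :
    flagWeight c (insert G 𝓣) = flagWeight c (insert G' 𝓣) := by
  obtain ⟨F, hF⟩ := h𝓣.exists_gap hM hr hcard
  have hflag := isCompleteFlag_insert hcard hG
  have hflag' := isCompleteFlag_insert hcard hG'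
  obtain ⟨K, hK⟩ := exists_isGreatest_of_isChain hflag.isFlag.2 ⟨G, mem_insert _ _⟩
  have hKd := hflag.rk_eq hM hr hK
  by_cases hK𝓣 : K ∈ 𝓣
  · have hK' := hflag'.isFlag.isGreatest_of_rk_eq hM hr (.inr hK𝓣) hKd
    have hKadm := h𝓣.admissible hK𝓣
    obtain ⟨a, ha⟩ := h𝓣.admChain.nonempty K hK𝓣
    refine flagWeight_eq_of_isGreatest hM hr hc hflag hflag' hK hK' (b := star a) (F := K) ?_
      hKd.ge ?_
    · rw [(h𝓣.isFlat hK𝓣).closure]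
      exact hKadm.star_notMem ha
    · rw [inter_self]
      exact insert_subset (.inr (by simpa using ha)) subset_union_left
  · obtain rfl := hK.1.resolve_right hK𝓣
    obtain ⟨T, hT, hKT⟩ | ⟨a, ha, ha'⟩ := htied
    · exact (hK𝓣 ((hK.2 (.inr hT)).antisymm hKT ▸ hT)).elim
    have hG'F := hF.rk_eq G' hG'
    rw [← hF.rk_eq K hG, hKd] at hG'F
    have hG'top := hflag'.isFlag.isGreatest_of_rk_eq hM hr (mem_insert _ _) hG'F
    have haF : a ∉ F := fun haF =>
      (admissible_of_mem_extFlats hG').star_notMem (hF.subset hM hG' haF) ha'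
    have hcl := hF.closure_insert_eq hM hG ha haF
    refine flagWeight_eq_of_isGreatest hM hr hc hflag hflag' hK hG'top (b := star a)
      (F := insert a F) ?_ ?_ ?_
    · exact hcl ▸ (admissible_of_mem_extFlats hG).star_notMem ha
    · rw [← rk_closure, hcl, hKd]
    · refine insert_subset ⟨.inr (by simpa using ha), .inl ha'⟩
        (insert_subset ⟨.inl ha, .inr (mem_starSet.2 ha')⟩ fun x hx => ?_)
      exact ⟨.inl (hF.subset hM hG hx), .inl (hF.subset hM hG' hx)⟩

theorem isMinkowskiWeight_iff_linked (hM : IsAdmissibleMatroid M) (hr : rk M univ = d + 1)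
    (c : conesOfDim (bergmanFan M) d → ℤ) :
    IsMinkowskiWeight (bergmanFan M) d c ↔ ∀ σ σ', Linked M d σ σ' → c σ = c σ' :=
  (isMinkowskiWeight_iff_balanced c).trans
    ⟨fun hc _ _ => eq_of_linked hM hr hc, fun hc => (balanced_iff hM hr).2
      fun _ h𝓣 hcard _ hG _ hG' => flagWeight_eq_of_tied hM hr hc h𝓣 hcard hG hG'⟩

theorem isMinkowskiWeight_iff_reflTransGen (hM : IsAdmissibleMatroid M) (hr : rk M univ = d + 1)
    (c : conesOfDim (bergmanFan M) d → ℤ) :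
    IsMinkowskiWeight (bergmanFan M) d c ↔
      ∀ σ σ', Relation.ReflTransGen (Linked M d) σ σ' → c σ = c σ' := by
  rw [isMinkowskiWeight_iff_linked hM hr]
  refine ⟨fun h σ σ' hσ => ?_, fun h σ σ' hl => h σ σ' (.single hl)⟩
  induction hσ with
  | refl => rfl
  | tail _ hl ih => exact ih.trans (h _ _ hl)

lemma IsEnvelopingMatroid.eRank_eq {S : Set (Set (J n))} {r : ℕ∞} (hM : IsEnvelopingMatroid M S)
    (hrank : ∀ B ∈ S, B.encard = r) : M.eRank = r := by
  obtain ⟨B, hB⟩ := hM.nonempty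
  have hcard := hrank B hB
  rw [hM.eq_bases] at hB
  rwa [hB.1.encard_eq_eRank] at hcard

end Linked

end RankedSymplectic

open RankedSymplectic in
/-- An admissible matroid of rank `d + 1` need not have an admissible basis: the uniform matroid of
rank `3` on `{1, 2, 1*, 2*}` has none. -/
theorem theorem5p12_general {n d : ℕ} {M : Matroid (J n)} (hM : IsAdmissibleMatroid M)
    (hrank : M.eRank = (d : ℕ∞) + 1) :
    (∀ σ σ' : conesOfDim (bergmanFan M) d,
      (∀ c : conesOfDim (bergmanFan M) d → ℤ,
        IsMinkowskiWeight (bergmanFan M) d c → c σ = c σ') ↔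
      Relation.ReflTransGen (Linked M d) σ σ') ∧
    (∀ c : conesOfDim (bergmanFan M) d → ℤ,
      IsMinkowskiWeight (bergmanFan M) d c ↔
      ∀ σ σ' : conesOfDim (bergmanFan M) d,
        Relation.ReflTransGen (Linked M d) σ σ' → c σ = c σ') := by
  classical
  have hr : rk M Set.univ = d + 1 := by
    rw [← Matroid.eRk_univ_eq, ← coe_rk] at hrank
    exact_mod_cast hrank
  have key := isMinkowskiWeight_iff_reflTransGen hM hr
  refine ⟨fun σ σ' => ⟨fun h => ?_, fun h c hc => (key c).1 hc σ σ' h⟩, key⟩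
  have : Std.Symm (Linked M d) := ⟨fun _ _ => Linked.symm⟩
  have hw := (key fun τ => if Relation.ReflTransGen (Linked M d) σ τ then 1 else 0).2
    fun τ τ' hτ => if_congr ⟨(·.trans hτ), (·.trans (symm hτ))⟩ rfl rfl
  simpa [Relation.ReflTransGen.refl] using (h _ hw).symm

theorem theorem5p12 {n : ℕ} (d : ℕ) (S : Set (Set (RankedSymplectic.J n)))
    (M : Matroid (RankedSymplectic.J n))
    (hM : RankedSymplectic.IsEnvelopingMatroid M S)
    (hrank : ∀ B ∈ S, B.encard = (d : ℕ∞) + 1) :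
    (∀ σ σ' : RankedSymplectic.conesOfDim (RankedSymplectic.bergmanFan M) d,
      (∀ c : RankedSymplectic.conesOfDim (RankedSymplectic.bergmanFan M) d → ℤ,
        RankedSymplectic.IsMinkowskiWeight (RankedSymplectic.bergmanFan M) d c → c σ = c σ') ↔
      Relation.ReflTransGen (RankedSymplectic.Linked M d) σ σ') ∧
    (∀ c : RankedSymplectic.conesOfDim (RankedSymplectic.bergmanFan M) d → ℤ,
      RankedSymplectic.IsMinkowskiWeight (RankedSymplectic.bergmanFan M) d c ↔
      ∀ σ σ' : RankedSymplectic.conesOfDim (RankedSymplectic.bergmanFan M) d,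
        Relation.ReflTransGen (RankedSymplectic.Linked M d) σ σ' → c σ = c σ') :=
  theorem5p12_general hM.admissible (hM.eRank_eq hrank)
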